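/- An independent $[1,2]$-set of a graph $G$ is an independent set $S\subseteq V(G)$ such that every vertex outside $S$ has one or two neighbours in $S$. For a vertex $v$ of a graph $G$ with at least two vertices, an independent set $S$ is of type I for $v$ if every vertex outside $S\cup\{v\}$ has one or two neighbours in $S$ and $v$ either is in $S$ or has at most two neighbours in $S$; the label $L_S(v)$ is then $0$ if $v\in S$, it is $k$ if $v\notin S$ has $k\in\{1,2\}$ neighbours in $S$, and if $v\notin S$ has no neighbour in $S$ it is $-2$ if some neighbour of $v$ has two neighbours in $S$, and $-1$ otherwise. **Algorithm.** Input: a tree $T$ with $n$ vertices, given by adjacency lists (in any order). If $T$ has no vertex of degree at least $2$ (so $n\le 2$), answer YES. Otherwise: 1. Choose an internal (non-leaf) vertex $r$ as the root, and number the internal vertices so that every proper descendant has a smaller number than its ancestors. Put $R(u)=\emptyset$ for every vertex $u$. 2. Process the internal vertices $v$ in increasing order of their numbers. * If $v$ is adjacent to $q\ge 1$ leaves, put $R(v)=\{0,1\}$ if $q=1$, $R(v)=\{0,2\}$ if $q=2$, $R(v)=\{0\}$ if $q\ge 3$. If $v$ is adjacent to no leaf, pick its first child $u$ and let $R(v)$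 consist of the labels arising from the labels in $R(u)$ by $2\mapsto -2$; $1\mapsto -1$; $-2,-1,1\mapsto 0$; $0\mapsto 1$. * For each remaining internal child $u$ of $v$, replace $R(v)$ by the set of labels arising from the pairs $(a,b)\in R(u)\times R(v)$ by $(1,-2),(2,-2),(2,-1)\mapsto -2$; $(1,-1)\mapsto -1$; $(-2,0),(-1,0),(1,0)\mapsto 0$; $(0,-2),(0,-1),(1,1),(2,1)\mapsto 1$; $(0,1),(1,2),(2,2)\mapsto 2$. * If $R(v)=\emptyset$, answer NO and end. 3. Answer YES if $R(r)\cap\{0,1,2\}\ne\emptyset$, and NO otherwise. **Theorem.** The algorithm decides in $O(n)$ time whether or not a tree $T$ with $n$ vertices has an independent $[1,2]$-set. More precisely, consider a random access machine with uniform cost, whose only arithmetic operations are successor and predecessor, which can read the degree of a vertex and the entries of its adjacency list, and on which the algorithm is written as one fixed program (step 1 by breadth-first search). There is a constant $C$ such that for every tree $T$ with $n\ge 1$ vertices, given by any adjacency lists: (a) from every initial memory, the program halts within $Cn$ steps, with the answer YES if $T$ has an independent $[1,2]$-set and NO if it has none; (b) if $n\ge 3$, the choice of a root and the numbering in step 1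 are made correctly, within $Cn$ steps; (c) for every admissible choice of an internal root $r$ and of the numbering in step 1, the rest of the program halts within $Cn$ steps with the correct answer, and for every internal vertex $v$ such that the list computed for no earlier vertex is empty, in the sense that every internal vertex $u$ with a smaller number has a type I set in the subtree $T_u$ rooted at $u$, the final list is $R(v)=\{L_S(v): S \text{ of type I for } v \text{ in } T_v\}$, which is a subset of $\{-2,-1,0,1,2\}$. -/

import Mathlib

namespace TreeOneTwo

/-! ## Independent [1,2]-sets, type I sets and their labels -/

section Graphs

variable {V : Type*}

/-- The number of neighbours of `v` in `S`. -/
noncomputable def nbrCount (G : SimpleGraph V) (S : Set V) (v : V) : ℕ :=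
  (G.neighborSet v ∩ S).ncard

/-- `S` is independent and every vertex outside `S` has one or two neighbours in `S`. -/
def IsIndepOneTwoSet (G : SimpleGraph V) (S : Set V) : Prop :=
  G.IsIndepSet S ∧ ∀ u, u ∉ S → 1 ≤ nbrCount G S u ∧ nbrCount G S u ≤ 2

/-- `S` is of type I for `v`: it is independent, every vertex outside `S` other than `v` has one
or two neighbours in `S`, and `v` is in `S` or has at most two neighbours in `S`. -/
def IsTypeI (G : SimpleGraph V) (v : V) (S : Set V) : Prop :=
  G.IsIndepSet S ∧
  (∀ u, u ∉ S → u ≠ v → 1 ≤ nbrCount G S u ∧ nbrCount G S u ≤ 2) ∧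
  (v ∉ S → nbrCount G S v ≤ 2)

open Classical in
/-- The label `L_S(v)` of `v` with respect to a set `S` of type I for `v`. -/
noncomputable def typeILabel (G : SimpleGraph V) (v : V) (S : Set V) : ℤ :=
  if v ∈ S then 0
  else if 1 ≤ nbrCount G S v then (nbrCount G S v : ℤ)
  else if ∃ u, G.Adj v u ∧ nbrCount G S u = 2 then -2
  else -1

/-- The vertices of the subtree rooted at `v` when the tree `G` is rooted at `r`: those `u` that
cannot be reached from `r` without passing through `v`. -/
def subtree (G : SimpleGraph V) (r v : V) : Set V :=
  {u | ∀ p : G.Walk r u, v ∈ p.support}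

theorem self_mem_subtree (G : SimpleGraph V) (r v : V) : v ∈ subtree G r v :=
  fun p => p.end_mem_support

/-- All labels `L_S(v)`, where `S` is of type I for `v` in the subtree rooted at `v`. -/
def possibleLabels (G : SimpleGraph V) (r v : V) : Set ℤ :=
  {k | ∃ S : Set (subtree G r v),
      IsTypeI (G.induce (subtree G r v)) ⟨v, self_mem_subtree G r v⟩ S ∧
      typeILabel (G.induce (subtree G r v)) ⟨v, self_mem_subtree G r v⟩ S = k}

/-- The internal (non-leaf) vertices. -/
def IsInternal (G : SimpleGraph V) (v : V) : Prop :=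
  2 ≤ (G.neighborSet v).ncard

end Graphs

/-! ## A random access machine with uniform cost

Programs work on finitely many registers and arrays of natural numbers. The input is a graph in
adjacency-list form, which can only be read. The only arithmetic operations are successor and
predecessor. Every node of every expression, every command and every iteration costs one step. -/

/-- The five labels -2, -1, 0, 1, 2. -/
inductive Label
  | neg2 | neg1 | zero | one | two
  deriving DecidableEq

/-- The integer that a label stands for. -/
def Label.toInt : Label → ℤ
  | .neg2 => -2
  | .neg1 => -1
  | .zero => 0
  | .one => 1
  | .two => 2

/-- The list of all labels. -/
def Label.all : List Label := [.neg2, .neg1, .zero, .one, .two]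

/-- The registers. -/
inductive Var
  | root | found | count | i | j | k | u | v | w | leaves | picked | stopped | answer
  | tmp (l : Label)
  deriving DecidableEq

/-- The arrays. The arrays `R l` hold the lists `R(v)`: the label `l` is in the list `R(v)` when
cell `v` of `R l` holds `1`, and it is not when that cell holds `0`. -/
inductive Arr
  | queue | par | lab | vert
  | R (l : Label)
  deriving DecidableEq

/-- The contents of the memory. -/
structure State where
  var : Var → ℕ
  arr : Arr → ℕ → ℕ

/-- Write to a register. -/
def State.setVar (s : State) (x : Var) (a : ℕ) : State :=
  { s with var := Function.update s.var x a }

/-- Write to a cell of an array. -/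
def State.setArr (s : State) (b : Arr) (i a : ℕ) : State :=
  { s with arr := Function.update s.arr b (Function.update (s.arr b) i a) }

/-- An input: a number `n` of vertices, and for each vertex `u < n` the list `adj u`. -/
structure Input where
  n : ℕ
  adj : ℕ → List ℕ

/-- The input `A` is an adjacency-list representation, in any order, of the graph `T`. -/
def Input.Represents (A : Input) {n : ℕ} (T : SimpleGraph (Fin n)) : Prop :=
  A.n = n ∧ ∀ u : Fin n, (A.adj u).Nodup ∧
    ∀ w : ℕ, w ∈ A.adj u ↔ ∃ h : w < n, T.Adj u ⟨w, h⟩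

/-- Expressions. `deg e` is the length of the adjacency list of `e`, and `nbr e f` is the entry of
that list at position `f` (the first position is `0`). -/
inductive Expr
  | const (a : ℕ)
  | var (x : Var)
  | arr (b : Arr) (e : Expr)
  | succ (e : Expr)
  | pred (e : Expr)
  | size
  | deg (e : Expr)
  | nbr (e f : Expr)

/-- The value of an expression. -/
def Expr.eval (A : Input) (s : State) : Expr → ℕ
  | .const a => a
  | .var x => s.var x
  | .arr b e => s.arr b (e.eval A s)
  | .succ e => e.eval A s + 1
  | .pred e => e.eval A s - 1
  | .size => A.n
  | .deg e => (A.adj (e.eval A s)).length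
  | .nbr e f => (A.adj (e.eval A s)).getD (f.eval A s) 0

/-- The number of steps to evaluate an expression. -/
def Expr.cost : Expr → ℕ
  | .const _ => 1
  | .var _ => 1
  | .arr _ e => e.cost + 1
  | .succ e => e.cost + 1
  | .pred e => e.cost + 1
  | .size => 1
  | .deg e => e.cost + 1
  | .nbr e f => e.cost + f.cost + 1

/-- Conditions. -/
inductive Cond
  | tt
  | ff
  | eq (e f : Expr)
  | lt (e f : Expr)
  | not (b : Cond)
  | and (b c : Cond)
  | or (b c : Cond)

/-- The truth value of a condition. -/
def Cond.eval (A : Input) (s : State) : Cond → Bool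
  | .tt => true
  | .ff => false
  | .eq e f => decide (e.eval A s = f.eval A s)
  | .lt e f => decide (e.eval A s < f.eval A s)
  | .not b => !(b.eval A s)
  | .and b c => b.eval A s && c.eval A s
  | .or b c => b.eval A s || c.eval A s

/-- The number of steps to evaluate a condition. -/
def Cond.cost : Cond → ℕ
  | .tt => 1
  | .ff => 1
  | .eq e f => e.cost + f.cost + 1
  | .lt e f => e.cost + f.cost + 1
  | .not b => b.cost + 1
  | .and b c => b.cost + c.cost + 1
  | .or b c => b.cost + c.cost + 1

/-- Commands. `loop x e c` evaluates `e` once, and then executes `c` for `x = 0, 1, …, e - 1`. -/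
inductive Cmd
  | skip
  | set (x : Var) (e : Expr)
  | store (b : Arr) (i e : Expr)
  | seq (c d : Cmd)
  | ite (b : Cond) (c d : Cmd)
  | loop (x : Var) (e : Expr) (c : Cmd)

/-- The memory after the execution of a command, and the number of steps of that execution. -/
def Cmd.run (A : Input) : Cmd → State → State × ℕ
  | .skip, s => (s, 1)
  | .set x e, s => (s.setVar x (e.eval A s), e.cost + 1)
  | .store b i e, s => (s.setArr b (i.eval A s) (e.eval A s), i.cost + e.cost + 1)
  | .seq c d, s =>
      ((d.run A (c.run A s).1).1, (c.run A s).2 + (d.run A (c.run A s).1).2 + 1)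
  | .ite b c d, s =>
      (if b.eval A s then (c.run A s).1 else (d.run A s).1,
        b.cost + (if b.eval A s then (c.run A s).2 else (d.run A s).2) + 1)
  | .loop x e c, s =>
      (List.range (e.eval A s)).foldl
        (fun p m => ((c.run A (p.1.setVar x m)).1, p.2 + (c.run A (p.1.setVar x m)).2 + 1))
        (s, e.cost + 1)

/-- Execute the commands of a list one after the other. -/
def Cmd.block : List Cmd → Cmd
  | [] => .skip
  | c :: cs => .seq c (Cmd.block cs)

/-- A conditional command without alternative. -/
def Cmd.when (b : Cond) (cs : List Cmd) : Cmd := .ite b (Cmd.block cs) .skip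

/-- The disjunction of the conditions of a list. -/
def Cond.any : List Cond → Cond
  | [] => .ff
  | b :: bs => .or b (Cond.any bs)

/-! ## The algorithm -/

/-- The vertex `e` is not a leaf. -/
def internalTest (e : Expr) : Cond := .lt (.const 1) (.deg e)

/-- The label `l` is in the list of the vertex `e`. -/
def hasLabel (l : Label) (e : Expr) : Cond := .eq (.arr (.R l) e) (.const 1)

/-- The first phase: choose an internal vertex as the root (`found` tells whether there is one),
and number the `count` internal vertices by `0, …, count - 1` in such a way that proper descendants
get smaller numbers than their ancestors. The search is breadth first; `lab` is the numbering
and `vert` its inverse. -/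
def orderPhase : Cmd := .block [
  .set .found (.const 0),
  .loop .i .size (.when (internalTest (.var .i))
    [.set .root (.var .i), .set .found (.const 1)]),
  .when (.eq (.var .found) (.const 1)) [
    .store .queue (.const 0) (.var .root),
    .store .par (.var .root) (.var .root),
    .set .count (.const 1),
    .loop .i .size (.when (.lt (.var .i) (.var .count)) [
      .set .u (.arr .queue (.var .i)),
      .loop .j (.deg (.var .u)) (.block [
        .set .w (.nbr (.var .u) (.var .j)),
        .when (.and (internalTest (.var .w)) (.not (.eq (.var .w) (.arr .par (.var .u))))) [
          .store .par (.var .w) (.var .u),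
          .store .queue (.var .count) (.var .w),
          .set .count (.succ (.var .count))]])]),
    .set .k (.var .count),
    .loop .i (.var .count) (.block [
      .set .k (.pred (.var .k)),
      .set .u (.arr .queue (.var .i)),
      .store .vert (.var .k) (.var .u),
      .store .lab (.var .u) (.var .k)])]]

/-- Replace the list `R(v)` by the list of those labels `l` for which `f l` holds now. -/
def actualize (f : Label → Cond) : Cmd := .block
  (Label.all.map (fun l => .ite (f l) (.set (.tmp l) (.const 1)) (.set (.tmp l) (.const 0))) ++
    Label.all.map (fun l => .store (.R l) (.var .v) (.var (.tmp l))))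

/-- The labels of the centre of a star with `leaves ≥ 1` leaves. -/
def starRule : Label → Cond
  | .zero => .tt
  | .one => .eq (.var .leaves) (.const 1)
  | .two => .eq (.var .leaves) (.const 2)
  | _ => .ff

/-- A new vertex is joined to a vertex `v` of a graph: the label `l` of the new vertex arises from
the labels `oneVertexTable l` of `v`. -/
def oneVertexTable : Label → List Label
  | .neg2 => [.two]
  | .neg1 => [.one]
  | .zero => [.neg2, .neg1, .one]
  | .one => [.zero]
  | .two => []

/-- A vertex `v` of a graph is joined to a vertex `v'` of another graph: the label `l` of `v'` in
the union arises from the pairs `twoGraphsTable l` of a label of `v` and a label of `v'`. -/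
def twoGraphsTable : Label → List (Label × Label)
  | .neg2 => [(.one, .neg2), (.two, .neg2), (.two, .neg1)]
  | .neg1 => [(.one, .neg1)]
  | .zero => [(.neg2, .zero), (.neg1, .zero), (.one, .zero)]
  | .one => [(.zero, .neg2), (.zero, .neg1), (.one, .one), (.two, .one)]
  | .two => [(.zero, .one), (.one, .two), (.two, .two)]

/-- The new list of `v` after adding its first child `u`. -/
def oneVertexRule (l : Label) : Cond :=
  .any ((oneVertexTable l).map (fun a => hasLabel a (.var .u)))

/-- The new list of `v` after adding a further child `u` with its subtree. -/
def twoGraphsRule (l : Label) : Cond :=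
  .any ((twoGraphsTable l).map (fun p => .and (hasLabel p.1 (.var .u)) (hasLabel p.2 (.var .v))))

/-- The internal neighbour `u` of `v` is a child of `v`. -/
def childTest : Cond := .lt (.arr .lab (.var .u)) (.arr .lab (.var .v))

/-- Compute the list `R(v)` for the vertex in the register `v`. -/
def processVertex : Cmd := .block [
  .set .leaves (.const 0),
  .loop .j (.deg (.var .v)) (.block [
    .set .u (.nbr (.var .v) (.var .j)),
    .when (.not (internalTest (.var .u))) [.set .leaves (.succ (.var .leaves))]]),
  .ite (.lt (.const 0) (.var .leaves))
    (.block [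
      actualize starRule,
      .loop .j (.deg (.var .v)) (.block [
        .set .u (.nbr (.var .v) (.var .j)),
        .when (.and (internalTest (.var .u)) childTest) [actualize twoGraphsRule]])])
    (.block [
      .set .picked (.const 0),
      .loop .j (.deg (.var .v)) (.block [
        .set .u (.nbr (.var .v) (.var .j)),
        .when childTest [
          .ite (.eq (.var .picked) (.const 0))
            (.block [actualize oneVertexRule, .set .picked (.const 1)])
            (actualize twoGraphsRule)]])])]

/-- The second phase: process the internal vertices in the order of their numbers, stop with the
answer NO (`0`) as soon as a list is empty, and otherwise answer YES (`1`) exactly when the list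
of the root contains one of `0`, `1`, `2`. -/
def labelPhase : Cmd := .block [
  .loop .i .size (.block (Label.all.map (fun l => .store (.R l) (.var .i) (.const 0)))),
  .set .stopped (.const 0),
  .loop .i (.var .count) (.when (.eq (.var .stopped) (.const 0)) [
    .set .v (.arr .vert (.var .i)),
    processVertex,
    .when (.not (.any (Label.all.map (fun l => hasLabel l (.var .v))))) [
      .set .answer (.const 0), .set .stopped (.const 1)]]),
  .when (.eq (.var .stopped) (.const 0)) [
    .ite (.any ([.zero, .one, .two].map (fun l => hasLabel l (.var .root))))
      (.set .answer (.const 1)) (.set .answer (.const 0))]]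

/-- The whole algorithm. A tree without internal vertices has at most two vertices; then the
answer is YES. -/
def treeAlgorithm : Cmd := .block [
  orderPhase,
  .ite (.eq (.var .found) (.const 1)) labelPhase (.set .answer (.const 1))]

/-- The memory `s` holds an admissible choice of the first phase: an internal vertex `r` as the root
and an admissible numbering of the internal vertices together with its inverse. -/
structure IsBottomUpNumbering {n : ℕ} (T : SimpleGraph (Fin n)) (r : Fin n) (s : State) :
    Prop where
  root_internal : IsInternal T r
  root_eq : s.var .root = r
  count_eq : s.var .count = {v | IsInternal T v}.ncard
  lab_lt : ∀ v, IsInternal T v → s.arr .lab v < s.var .count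
  vert_lab : ∀ v : Fin n, IsInternal T v → s.arr .vert (s.arr .lab v) = v
  desc_lt : ∀ u v, IsInternal T u → IsInternal T v → u ≠ v → u ∈ subtree T r v →
    s.arr .lab u < s.arr .lab v

/-- The list `R(v)` in the memory `s`, as a set of integers. -/
def labelList (s : State) (v : ℕ) : Set ℤ :=
  {k | ∃ l : Label, l.toInt = k ∧ s.arr (.R l) v = 1}

/-- The answer in the memory `s` is YES if `T` has an independent [1,2]-set and NO if not. -/
def AnswerCorrect {n : ℕ} (T : SimpleGraph (Fin n)) (s : State) : Prop :=
  (s.var .answer = 1 ∧ ∃ S, IsIndepOneTwoSet T S) ∨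
  (s.var .answer = 0 ∧ ¬ ∃ S, IsIndepOneTwoSet T S)

end TreeOneTwo

/-! A set of type I for `v` relaxes the condition at `v` alone, because `v` may still gain a
neighbour in the set when its parent is attached. Let `X ∋ v` and `Y ∋ u` be disjoint, with `vu` the
only edge between them. A set `S ⊆ X ∪ Y` is the union of `S ∩ X` and `S ∩ Y`, and passing from the
two parts to `S` changes neighbour counts only at `v` and `u`. So `S` is of type I for `v` exactly
when both parts are of type I and their labels form a pair in the table, which also gives the new
label. This is a finite check (`join_label_iff`, `join_iff`, `labelsOn_union`).

In a rooted tree the edge from a child `c` to `v` is the only edge that leaves the subtree of `c`.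
Hence the subtree of `v` is built from the single vertex `v`, with labels -1 and 0, by joining the
subtrees of its children in any order (`labelsOn_branch_insert`). The other two tables are special
cases: a leaf is a subtree with labels -1 and 0, which gives the star rule, and joining the first
child to the bare vertex `v` gives the one-vertex rule.

Within the subtree of `v` only `v` can have a neighbour outside it, so an independent [1,2]-set of
the tree meets this subtree in a set of type I for `v`. An empty list therefore proves that the
answer is NO (`labelsOn_subtree_nonempty`). The subtree of the root is the whole tree, and a label
0, 1 or 2 is exactly the condition that type I leaves open at the root
(`exists_isIndepOneTwoSet_iff`).

Breadth-first search queues parents before children, so the reversed queue is an admissible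
numbering. The work for one vertex is at most `a + b * deg`, where `a` and `b` are read off the
program text (`Cmd.cost_le_of_scans`). The degrees of a tree sum to less than `2 * n`, so the total
is linear (`sum_cost_le`). -/

namespace TreeOneTwo

/-! ### Labels, and how they combine along one edge -/

section Labels

variable {V : Type*}

/-- `S` is of type I for `v` in the subgraph of `G` induced by `X`. -/
def IsTypeIOn (G : SimpleGraph V) (X : Set V) (v : V) (S : Set V) : Prop :=
  S ⊆ X ∧ G.IsIndepSet S ∧
  (∀ u ∈ X, u ∉ S → u ≠ v → 1 ≤ nbrCount G S u ∧ nbrCount G S u ≤ 2) ∧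
  (v ∉ S → nbrCount G S v ≤ 2)

/-- The label of `v` with respect to `S` in the subgraph of `G` induced by `X` is `l`. -/
def HasLabelOn (G : SimpleGraph V) (X : Set V) (v : V) (S : Set V) : Label → Prop
  | .zero => v ∈ S
  | .one => v ∉ S ∧ nbrCount G S v = 1
  | .two => v ∉ S ∧ nbrCount G S v = 2
  | .neg2 => v ∉ S ∧ nbrCount G S v = 0 ∧ ∃ u ∈ X, G.Adj v u ∧ nbrCount G S u = 2
  | .neg1 => v ∉ S ∧ nbrCount G S v = 0 ∧ ¬ ∃ u ∈ X, G.Adj v u ∧ nbrCount G S u = 2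

/-- The possible labels of `v` in the subgraph of `G` induced by `X`. -/
def labelsOn (G : SimpleGraph V) (X : Set V) (v : V) : Set Label :=
  {l | ∃ S, IsTypeIOn G X v S ∧ HasLabelOn G X v S l}

/-- The labels that arise by joining a vertex with labels in `P` to a vertex with labels
in `Q`. -/
def joinLabels (P Q : Set Label) : Set Label :=
  {l | ∃ p ∈ twoGraphsTable l, p.1 ∈ P ∧ p.2 ∈ Q}

theorem nbrCount_induce (G : SimpleGraph V) (X : Set V) (S : Set X) (u : X) :
    nbrCount (G.induce X) S u = nbrCount G (Subtype.val '' S) u := by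
  unfold nbrCount
  rw [← Set.ncard_image_of_injective _ Subtype.val_injective]
  congr 1
  ext w
  simp only [Set.mem_image, Set.mem_inter_iff, SimpleGraph.mem_neighborSet,
    SimpleGraph.comap_adj, Function.Embedding.subtype_apply]
  constructor
  · rintro ⟨x, ⟨h1, h2⟩, rfl⟩
    exact ⟨h1, x, h2, rfl⟩
  · rintro ⟨h1, x, h2, rfl⟩
    exact ⟨x, ⟨h1, h2⟩, rfl⟩

theorem isTypeI_induce_iff (G : SimpleGraph V) (X : Set V) (v : X) (S : Set X) :
    IsTypeI (G.induce X) v S ↔ IsTypeIOn G X v (Subtype.val '' S) := by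
  unfold IsTypeI IsTypeIOn
  have h1 : (G.induce X).IsIndepSet S ↔ G.IsIndepSet (Subtype.val '' S) := by
    simp only [SimpleGraph.IsIndepSet, Set.Pairwise, Set.mem_image, SimpleGraph.comap_adj,
      Function.Embedding.subtype_apply]
    constructor
    · rintro h _ ⟨x, hx, rfl⟩ _ ⟨y, hy, rfl⟩ hne
      exact h hx hy (fun e => hne (by rw [e]))
    · intro h x hx y hy hne
      exact h ⟨x, hx, rfl⟩ ⟨y, hy, rfl⟩ (fun e => hne (Subtype.ext e))
  have h2 : ∀ u : X, (u : V) ∈ Subtype.val '' S ↔ u ∈ S := fun u => by simp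
  simp only [h1, nbrCount_induce, h2]
  constructor
  · rintro ⟨a, b, c⟩
    refine ⟨by rintro _ ⟨x, _, rfl⟩; exact x.2, a, ?_, c⟩
    intro u hu hS hne
    exact b ⟨u, hu⟩ (fun h => hS ((h2 ⟨u, hu⟩).2 h)) (fun e => hne (by rw [← e]))
  · rintro ⟨-, a, b, c⟩
    refine ⟨a, ?_, c⟩
    intro u hu hne
    exact b u u.2 (fun h => hu ((h2 u).1 h)) (fun e => hne (Subtype.ext e))

theorem typeILabel_eq_iff (G : SimpleGraph V) (X : Set V) (v : X) (S : Set X)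
    (hS : IsTypeI (G.induce X) v S) (l : Label) :
    typeILabel (G.induce X) v S = l.toInt ↔ HasLabelOn G X v (Subtype.val '' S) l := by
  have h2 : ∀ u : X, (u : V) ∈ Subtype.val '' S ↔ u ∈ S := fun u => by simp
  have h3 : (∃ u, (G.induce X).Adj v u ∧ nbrCount (G.induce X) S u = 2) ↔
      ∃ u ∈ X, G.Adj v u ∧ nbrCount G (Subtype.val '' S) u = 2 := by
    simp only [nbrCount_induce, SimpleGraph.comap_adj, Function.Embedding.subtype_apply]
    exact ⟨fun ⟨u, h⟩ => ⟨u, u.2, h⟩, fun ⟨u, hu, h⟩ => ⟨⟨u, hu⟩, h⟩⟩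
  have hb := hS.2.2
  rw [nbrCount_induce] at hb
  unfold typeILabel
  rw [h3, nbrCount_induce]
  generalize hk : nbrCount G (Subtype.val '' S) v = k at *
  by_cases hv : v ∈ S
  · cases l <;> simp [HasLabelOn, Label.toInt, hv]
  · have hb := hb hv
    have hv' : (v : V) ∉ Subtype.val '' S := fun h => hv ((h2 v).1 h)
    by_cases he : ∃ u ∈ X, G.Adj v u ∧ nbrCount G (Subtype.val '' S) u = 2
    · interval_cases k <;> cases l <;>
        simp only [HasLabelOn, Label.toInt, hv, hv', hk, he] <;> norm_num
    · interval_cases k <;> cases l <;>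
        simp only [HasLabelOn, Label.toInt, hv, hv', hk, he] <;> norm_num

theorem exists_hasLabelOn {G : SimpleGraph V} {X : Set V} {v : V} {S : Set V}
    (h : IsTypeIOn G X v S) : ∃ l, HasLabelOn G X v S l := by
  by_cases hv : v ∈ S
  · exact ⟨.zero, hv⟩
  have hb := h.2.2.2 hv
  have h3 : nbrCount G S v = 0 ∨ nbrCount G S v = 1 ∨ nbrCount G S v = 2 := by omega
  rcases h3 with h3 | h3 | h3
  · by_cases he : ∃ u ∈ X, G.Adj v u ∧ nbrCount G S u = 2
    · exact ⟨.neg2, hv, h3, he⟩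
    · exact ⟨.neg1, hv, h3, he⟩
  · exact ⟨.one, hv, h3⟩
  · exact ⟨.two, hv, h3⟩

/-- Passes from sets in an induced subgraph with integer labels to sets in `V` with labels in
`Label`. Sets that belong to different subtrees can then be united, and labels can be split into
cases. -/
theorem possibleLabels_eq (G : SimpleGraph V) (r v : V) :
    possibleLabels G r v = Label.toInt '' labelsOn G (subtree G r v) v := by
  ext k
  simp only [possibleLabels, labelsOn, Set.mem_image, Set.mem_ofPred_eq]
  constructor
  · rintro ⟨S, hS, rfl⟩
    have hS' := (isTypeI_induce_iff G _ _ S).1 hS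
    obtain ⟨l, hl⟩ := exists_hasLabelOn hS'
    exact ⟨l, ⟨_, hS', hl⟩, ((typeILabel_eq_iff G _ _ S hS l).2 hl).symm⟩
  · rintro ⟨l, ⟨S, hS, hl⟩, rfl⟩
    have hSS : Subtype.val '' (Subtype.val ⁻¹' S : Set (subtree G r v)) = S := by
      rw [Subtype.image_preimage_coe]
      exact Set.inter_eq_right.2 hS.1
    have h1 : IsTypeI (G.induce (subtree G r v)) ⟨v, self_mem_subtree G r v⟩
        (Subtype.val ⁻¹' S) := (isTypeI_induce_iff G _ _ _).2 (by rwa [hSS])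
    exact ⟨_, h1, (typeILabel_eq_iff G _ _ _ h1 l).2 (by rwa [hSS])⟩

theorem nbrCount_union_of_not_adj {G : SimpleGraph V} {S S' : Set V} {x : V}
    (h : ∀ y ∈ S', ¬ G.Adj x y) : nbrCount G (S ∪ S') x = nbrCount G S x := by
  unfold nbrCount
  congr 1
  ext w
  simp only [Set.mem_inter_iff, SimpleGraph.mem_neighborSet, Set.mem_union]
  constructor
  · rintro ⟨a, b | b⟩
    · exact ⟨a, b⟩
    · exact absurd a (h w b)
  · exact fun ⟨a, b⟩ => ⟨a, Or.inl b⟩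

open Classical in
theorem nbrCount_union_of_adj [Finite V] {G : SimpleGraph V} {S S' : Set V} {x u : V}
    (hd : u ∉ S) (hu : G.Adj x u) (h : ∀ y ∈ S', G.Adj x y → y = u) :
    nbrCount G (S ∪ S') x = nbrCount G S x + if u ∈ S' then 1 else 0 := by
  split_ifs with hS
  · unfold nbrCount
    have : G.neighborSet x ∩ (S ∪ S') = insert u (G.neighborSet x ∩ S) := by
      ext w
      simp only [Set.mem_inter_iff, SimpleGraph.mem_neighborSet, Set.mem_union,
        Set.mem_insert_iff]
      constructor
      · rintro ⟨a, b | b⟩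
        · exact Or.inr ⟨a, b⟩
        · exact Or.inl (h w b a)
      · rintro (rfl | ⟨a, b⟩)
        · exact ⟨hu, Or.inr hS⟩
        · exact ⟨a, Or.inl b⟩
    rw [this, Set.ncard_insert_of_notMem (fun hh => hd hh.2)]
  · exact nbrCount_union_of_not_adj (fun y hy ha => hS (h y hy ha ▸ hy))

/-- The base of the recursion. It serves both for a leaf and for a vertex `v` to which no child has
been joined yet. -/
theorem labelsOn_singleton (G : SimpleGraph V) (v : V) :
    labelsOn G {v} v = {.neg1, .zero} := by
  have h0 : nbrCount G (∅ : Set V) v = 0 := by simp [nbrCount]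
  ext l
  constructor
  · rintro ⟨S, hS, hl⟩
    rcases Set.subset_singleton_iff_eq.1 hS.1 with rfl | rfl
    · cases l <;> simp_all [HasLabelOn]
    · cases l <;> simp_all [HasLabelOn]
  · rintro (rfl | rfl)
    · refine ⟨∅, ⟨by simp, by simp [SimpleGraph.IsIndepSet], by simp, by simp [h0]⟩, ?_⟩
      simp [HasLabelOn, h0]
    · exact ⟨{v}, ⟨by simp, by simp [SimpleGraph.IsIndepSet], by simp, by simp⟩,
        by simp [HasLabelOn]⟩

-- The finite content of the join table. Here `a` and `b` count the neighbours of `u` and `v` within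
-- their own parts, `uA` and `vB` say that `u` and `v` are chosen, `P₁` and `P₂` collect the
-- conditions away from the new edge, and `e₁`, `e₂` say that a neighbour in the same part has count
-- two. Once the propositions are decided, each label is a question about small numbers.
open Classical in
theorem join_label_iff (P₁ P₂ vB uA e₁ e₂ : Prop) (a b : ℕ) (l : Label) :
    (((P₁ ∧ P₂) ∧ ¬ (vB ∧ uA) ∧
        (¬ uA → 1 ≤ a + (if vB then 1 else 0) ∧ a + (if vB then 1 else 0) ≤ 2) ∧
        (¬ vB → b + (if uA then 1 else 0) ≤ 2)) ∧
      match l with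
      | .zero => vB
      | .one => ¬ vB ∧ b + (if uA then 1 else 0) = 1
      | .two => ¬ vB ∧ b + (if uA then 1 else 0) = 2
      | .neg2 => ¬ vB ∧ b + (if uA then 1 else 0) = 0 ∧ (e₁ ∨ a + (if vB then 1 else 0) = 2)
      | .neg1 => ¬ vB ∧ b + (if uA then 1 else 0) = 0 ∧
          ¬ (e₁ ∨ a + (if vB then 1 else 0) = 2)) ↔
      ∃ p ∈ twoGraphsTable l, ((P₂ ∧ (¬ uA → a ≤ 2)) ∧
        match p.1 with
        | .zero => uA
        | .one => ¬ uA ∧ a = 1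
        | .two => ¬ uA ∧ a = 2
        | .neg2 => ¬ uA ∧ a = 0 ∧ e₂
        | .neg1 => ¬ uA ∧ a = 0 ∧ ¬ e₂) ∧ (P₁ ∧ (¬ vB → b ≤ 2)) ∧
        match p.2 with
        | .zero => vB
        | .one => ¬ vB ∧ b = 1
        | .two => ¬ vB ∧ b = 2
        | .neg2 => ¬ vB ∧ b = 0 ∧ e₁
        | .neg1 => ¬ vB ∧ b = 0 ∧ ¬ e₁ := by
  by_cases hP₁ : P₁
  swap
  · simp [hP₁]
  by_cases hP₂ : P₂
  swap
  · simp [hP₂]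
  by_cases hvB : vB <;> by_cases huA : uA <;> by_cases h₁ : e₁ <;> by_cases h₂ : e₂ <;>
    cases l <;>
    simp only [twoGraphsTable, hP₁, hP₂, hvB, huA, h₁, h₂, List.mem_cons, List.not_mem_nil,
      or_false, exists_eq_or_imp, exists_eq_left, if_true, if_false] <;>
    simp <;> omega

section Join

variable [Finite V] {G : SimpleGraph V} {X Y : Set V} {v u : V}
  (hv : v ∈ X) (hu : u ∈ Y) (hd : Disjoint X Y) (huv : G.Adj v u)
  (he : ∀ x ∈ X, ∀ y ∈ Y, G.Adj x y → x = v ∧ y = u)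

include hv hu hd huv he

-- Since `vu` is the only edge between `X` and `Y`, every count stays the same except at `v` and
-- `u`, where it grows by one if the other end is chosen. What remains after abstracting the
-- unchanged conditions is `join_label_iff`.
open Classical in
theorem join_iff {B A : Set V} (hB : B ⊆ X) (hA : A ⊆ Y) (l : Label) :
    (IsTypeIOn G (X ∪ Y) v (B ∪ A) ∧ HasLabelOn G (X ∪ Y) v (B ∪ A) l) ↔
      ∃ p ∈ twoGraphsTable l, (IsTypeIOn G Y u A ∧ HasLabelOn G Y u A p.1) ∧
        (IsTypeIOn G X v B ∧ HasLabelOn G X v B p.2) := by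
  have hXY : ∀ x ∈ X, x ∉ Y := fun x hx hy => Set.disjoint_left.1 hd hx hy
  have cX : ∀ x ∈ X, x ≠ v → nbrCount G (B ∪ A) x = nbrCount G B x := fun x hx hne =>
    nbrCount_union_of_not_adj fun y hy ha => hne (he x hx y (hA hy) ha).1
  have cY : ∀ y ∈ Y, y ≠ u → nbrCount G (B ∪ A) y = nbrCount G A y := fun y hy hne => by
    rw [Set.union_comm]
    exact nbrCount_union_of_not_adj fun x hx ha => hne (he x (hB hx) y hy ha.symm).2
  have cv : nbrCount G (B ∪ A) v = nbrCount G B v + if u ∈ A then 1 else 0 :=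
    nbrCount_union_of_adj (fun h => hXY u (hB h) hu) huv
      fun y hy ha => (he v hv y (hA hy) ha).2
  have cu : nbrCount G (B ∪ A) u = nbrCount G A u + if v ∈ B then 1 else 0 := by
    rw [Set.union_comm]
    exact nbrCount_union_of_adj (fun h => hXY v hv (hA h)) huv.symm
      fun y hy ha => (he y (hB hy) u hu ha.symm).1
  have mX : ∀ x ∈ X, (x ∈ B ∪ A ↔ x ∈ B) := fun x hx =>
    ⟨fun h => h.resolve_right fun h => hXY x hx (hA h), Or.inl⟩
  have mY : ∀ y ∈ Y, (y ∈ B ∪ A ↔ y ∈ A) := fun y hy =>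
    ⟨fun h => h.resolve_left fun h => hXY y (hB h) hy, Or.inr⟩
  have hind : G.IsIndepSet (B ∪ A) ↔
      G.IsIndepSet B ∧ G.IsIndepSet A ∧ ¬ (v ∈ B ∧ u ∈ A) := by
    constructor
    · intro h
      exact ⟨h.mono Set.subset_union_left, h.mono Set.subset_union_right,
        fun ⟨a, b⟩ => h (Or.inl a) (Or.inr b) huv.ne huv⟩
    · rintro ⟨h1, h2, h3⟩ x hx y hy hne ha
      rcases hx with hx | hx <;> rcases hy with hy | hy
      · exact h1 hx hy hne ha
      · obtain ⟨rfl, rfl⟩ := he x (hB hx) y (hA hy) ha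
        exact h3 ⟨hx, hy⟩
      · obtain ⟨rfl, rfl⟩ := he y (hB hy) x (hA hx) ha.symm
        exact h3 ⟨hy, hx⟩
      · exact h2 hx hy hne ha
  -- In `Y` the vertex `u` is exempt from the lower bound, but in the union only `v` is. The last
  -- conjunct is the condition that `u` now has to meet.
  have hdom : (∀ w ∈ X ∪ Y, w ∉ B ∪ A → w ≠ v →
        1 ≤ nbrCount G (B ∪ A) w ∧ nbrCount G (B ∪ A) w ≤ 2) ↔
      (∀ w ∈ X, w ∉ B → w ≠ v → 1 ≤ nbrCount G B w ∧ nbrCount G B w ≤ 2) ∧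
      (∀ w ∈ Y, w ∉ A → w ≠ u → 1 ≤ nbrCount G A w ∧ nbrCount G A w ≤ 2) ∧
      (u ∉ A → 1 ≤ nbrCount G (B ∪ A) u ∧ nbrCount G (B ∪ A) u ≤ 2) := by
    constructor
    · intro h
      refine ⟨fun w hw h1 h2 => ?_, fun w hw h1 h2 => ?_, fun h1 => ?_⟩
      · rw [← cX w hw h2]
        exact h w (Or.inl hw) (by rwa [mX w hw]) h2
      · rw [← cY w hw h2]
        exact h w (Or.inr hw) (by rwa [mY w hw]) (fun e => hXY v hv (e ▸ hw))
      · exact h u (Or.inr hu) (by rwa [mY u hu]) huv.ne'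
    · rintro ⟨h1, h2, h3⟩ w (hw | hw) hwS hne
      · rw [cX w hw hne]
        exact h1 w hw (by rwa [mX w hw] at hwS) hne
      · by_cases hwu : w = u
        · subst hwu
          exact h3 (by rwa [mY w hw] at hwS)
        · rw [cY w hw hwu]
          exact h2 w hw (by rwa [mY w hw] at hwS) hwu
  -- A neighbour of `v` in `X` keeps its count, and `u` is the only neighbour of `v` in `Y`. This
  -- decides between -2 and -1.
  have hex : (∃ w ∈ X ∪ Y, G.Adj v w ∧ nbrCount G (B ∪ A) w = 2) ↔
      (∃ w ∈ X, G.Adj v w ∧ nbrCount G B w = 2) ∨ nbrCount G (B ∪ A) u = 2 := by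
    constructor
    · rintro ⟨w, hw | hw, ha, h2⟩
      · exact Or.inl ⟨w, hw, ha, by rwa [← cX w hw ha.ne']⟩
      · obtain rfl := (he v hv w hw ha).2
        exact Or.inr h2
    · rintro (⟨w, hw, ha, h2⟩ | h2)
      · exact ⟨w, Or.inl hw, ha, by rwa [cX w hw ha.ne']⟩
      · exact ⟨u, Or.inr hu, huv, h2⟩
  have hsub : B ∪ A ⊆ X ∪ Y := Set.union_subset_union hB hA
  have key : IsTypeIOn G (X ∪ Y) v (B ∪ A) ↔
      ((G.IsIndepSet B ∧ ∀ w ∈ X, w ∉ B → w ≠ v → 1 ≤ nbrCount G B w ∧ nbrCount G B w ≤ 2) ∧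
      (G.IsIndepSet A ∧ ∀ w ∈ Y, w ∉ A → w ≠ u → 1 ≤ nbrCount G A w ∧ nbrCount G A w ≤ 2)) ∧
      ¬ (v ∈ B ∧ u ∈ A) ∧
      (u ∉ A → 1 ≤ nbrCount G A u + (if v ∈ B then 1 else 0) ∧
        nbrCount G A u + (if v ∈ B then 1 else 0) ≤ 2) ∧
      (v ∉ B → nbrCount G B v + (if u ∈ A then 1 else 0) ≤ 2) := by
    unfold IsTypeIOn
    rw [hind, hdom, cu, cv, mX v hv]
    exact ⟨fun ⟨_, ⟨i1, i2, i3⟩, ⟨d1, d2, d3⟩, c⟩ => ⟨⟨⟨i1, d1⟩, i2, d2⟩, i3, d3, c⟩,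
      fun ⟨⟨⟨i1, d1⟩, i2, d2⟩, i3, d3, c⟩ => ⟨hsub, ⟨i1, i2, i3⟩, ⟨d1, d2, d3⟩, c⟩⟩
  have keyX : IsTypeIOn G X v B ↔
      (G.IsIndepSet B ∧ ∀ w ∈ X, w ∉ B → w ≠ v → 1 ≤ nbrCount G B w ∧ nbrCount G B w ≤ 2) ∧
      (v ∉ B → nbrCount G B v ≤ 2) :=
    ⟨fun ⟨_, i, d, c⟩ => ⟨⟨i, d⟩, c⟩, fun ⟨⟨i, d⟩, c⟩ => ⟨hB, i, d, c⟩⟩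
  have keyY : IsTypeIOn G Y u A ↔
      (G.IsIndepSet A ∧ ∀ w ∈ Y, w ∉ A → w ≠ u → 1 ≤ nbrCount G A w ∧ nbrCount G A w ≤ 2) ∧
      (u ∉ A → nbrCount G A u ≤ 2) :=
    ⟨fun ⟨_, i, d, c⟩ => ⟨⟨i, d⟩, c⟩, fun ⟨⟨i, d⟩, c⟩ => ⟨hA, i, d, c⟩⟩
  rw [key, keyX, keyY]
  generalize (G.IsIndepSet B ∧ ∀ w ∈ X, w ∉ B → w ≠ v →
    1 ≤ nbrCount G B w ∧ nbrCount G B w ≤ 2) = P1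
  generalize (G.IsIndepSet A ∧ ∀ w ∈ Y, w ∉ A → w ≠ u →
    1 ≤ nbrCount G A w ∧ nbrCount G A w ≤ 2) = P2
  unfold HasLabelOn
  rw [hex, cv, cu, mX v hv]
  generalize (∃ w ∈ X, G.Adj v w ∧ nbrCount G B w = 2) = e1
  generalize (∃ w ∈ Y, G.Adj u w ∧ nbrCount G A w = 2) = e2
  generalize nbrCount G A u = a
  generalize nbrCount G B v = b
  generalize (v ∈ B) = vB
  generalize (u ∈ A) = uA
  exact join_label_iff P1 P2 vB uA e1 e2 a b l

theorem labelsOn_union :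
    labelsOn G (X ∪ Y) v = joinLabels (labelsOn G Y u) (labelsOn G X v) := by
  ext l
  constructor
  · rintro ⟨S, hS, hl⟩
    have hSe : S = (S ∩ X) ∪ (S ∩ Y) := by
      rw [← Set.inter_union_distrib_left]
      exact (Set.inter_eq_left.2 hS.1).symm
    rw [hSe] at hS hl
    obtain ⟨p, hp, h1, h2⟩ := (join_iff hv hu hd huv he Set.inter_subset_right
      Set.inter_subset_right l).1 ⟨hS, hl⟩
    exact ⟨p, hp, ⟨_, h1⟩, ⟨_, h2⟩⟩
  · rintro ⟨p, hp, ⟨A, hA⟩, ⟨B, hB⟩⟩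
    exact ⟨B ∪ A, (join_iff hv hu hd huv he hB.1.1 hA.1.1 l).2 ⟨p, hp, hA, hB⟩⟩

end Join
end Labels

/-! ### Rooted trees and the recursion over children -/

section Trees

variable {V : Type*} {T : SimpleGraph V} {r : V}

theorem subtree_trans {a b c : V} (h₁ : b ∈ subtree T r a) (h₂ : c ∈ subtree T r b) :
    c ∈ subtree T r a := by
  classical
  intro p
  exact p.support_takeUntil_subset_support (h₂ p) (h₁ _)

/-- A shortest walk from `r` to `b` passes `a` before its end. The distance from the root is thus a
measure for inductions that climb from a vertex to its parent. -/
theorem dist_lt_of_mem_subtree (hT : T.Connected) {a b : V} (h : b ∈ subtree T r a)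
    (hne : a ≠ b) : T.dist r a < T.dist r b := by
  classical
  obtain ⟨p, hp⟩ := hT.exists_walk_length_eq_dist r b
  rw [← hp]
  exact (SimpleGraph.dist_le _).trans_lt (p.length_takeUntil_lt_length (h p) hne)

theorem subtree_antisymm (hT : T.Connected) {a b : V} (h₁ : b ∈ subtree T r a)
    (h₂ : a ∈ subtree T r b) : a = b := by
  by_contra hne
  have := dist_lt_of_mem_subtree hT h₁ hne
  have := dist_lt_of_mem_subtree hT h₂ (Ne.symm hne)
  omega

theorem mem_subtree_root (v : V) : v ∈ subtree T r r := fun p => p.start_mem_support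

theorem eq_root_of_root_mem_subtree {a : V} (h : r ∈ subtree T r a) : a = r := by
  simpa using h (SimpleGraph.Walk.nil)

/-- Otherwise a path from `r` to `b` avoids `a` and a path from `r` to `a` avoids `b`. The first,
prolonged by the edge `ba`, is a second path to `a`, and it contains `b`, contrary to the uniqueness
of paths. -/
theorem mem_subtree_or_of_adj (hT : T.IsTree) {a b : V} (hab : T.Adj a b) :
    b ∈ subtree T r a ∨ a ∈ subtree T r b := by
  classical
  by_contra! h
  obtain ⟨h₁, h₂⟩ := h
  simp only [subtree, Set.mem_ofPred_eq, not_forall] at h₁ h₂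
  obtain ⟨p, hp⟩ := h₁
  obtain ⟨q, hq⟩ := h₂
  have hp' : a ∉ p.bypass.support := fun h => hp (p.support_bypass_subset_support h)
  have hq' : b ∉ q.bypass.support := fun h => hq (q.support_bypass_subset_support h)
  have h1 : (p.bypass.concat hab.symm).IsPath := (p.bypass_isPath).concat hp' hab.symm
  have h2 := (hT.isAcyclic.subsingleton_path _ _).elim ⟨_, h1⟩ ⟨_, q.bypass_isPath⟩
  have h3 : p.bypass.concat hab.symm = q.bypass := congrArg Subtype.val h2
  apply hq'
  rw [← h3]
  simp [SimpleGraph.Walk.support_concat]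

/-- Each of `a` and `b` is the last vertex but one of a path from `r` to `c`, and there is only one
such path. -/
theorem parent_unique (hT : T.IsTree) {a b c : V} (ha : T.Adj a c) (hac : c ∈ subtree T r a)
    (hb : T.Adj b c) (hbc : c ∈ subtree T r b) : a = b := by
  classical
  have key : ∀ {x : V} (hx : T.Adj x c), c ∈ subtree T r x →
      ∃ p : T.Walk r x, (p.concat hx).IsPath := by
    intro x hx hxc
    have : x ∉ subtree T r c := fun h => hx.ne (subtree_antisymm hT.connected hxc h)
    simp only [subtree, Set.mem_ofPred_eq, not_forall] at this
    obtain ⟨p, hp⟩ := this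
    exact ⟨p.bypass, p.bypass_isPath.concat (fun h => hp (p.support_bypass_subset_support h)) hx⟩
  obtain ⟨p, hp⟩ := key ha hac
  obtain ⟨q, hq⟩ := key hb hbc
  have h := congrArg Subtype.val ((hT.isAcyclic.subsingleton_path _ _).elim ⟨_, hp⟩ ⟨_, hq⟩)
  have h := congrArg SimpleGraph.Walk.penultimate h
  simpa using h

/-- A walk to `p` prolonged to `u` meets `v`, and not at its new end. As `p` may be any neighbour of
`u`, a subtree can be left only through its root `v`. -/
theorem mem_subtree_of_parent {v p u : V} (h : u ∈ subtree T r v) (hne : v ≠ u)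
    (hpu : T.Adj p u) : p ∈ subtree T r v := by
  intro w
  have := h (w.concat hpu)
  rw [SimpleGraph.Walk.support_concat] at this
  simpa [hne] using this

/-- The parent is the last vertex but one of a shortest walk from `r`; if it lay below `u` instead,
it would be farther from `r` than `u`. -/
theorem exists_parent (hT : T.IsTree) {u : V} (hu : u ≠ r) :
    ∃ p, T.Adj p u ∧ u ∈ subtree T r p := by
  obtain ⟨w, hw⟩ := hT.connected.exists_walk_length_eq_dist r u
  have hnil : ¬ w.Nil := SimpleGraph.Walk.not_nil_of_ne hu.symm
  have hadj := w.adj_penultimate hnil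
  refine ⟨w.penultimate, hadj, ?_⟩
  rcases mem_subtree_or_of_adj (r := r) hT hadj with h | h
  · exact h
  · have h1 := dist_lt_of_mem_subtree hT.connected h hadj.ne'
    have h2 : T.dist r w.penultimate ≤ w.length - 1 := by
      have := SimpleGraph.dist_le w.dropLast
      rwa [SimpleGraph.Walk.length_dropLast] at this
    omega

theorem exists_child_of_mem_subtree (hT : T.IsTree) {v u : V} (h : u ∈ subtree T r v)
    (hne : v ≠ u) : ∃ c, T.Adj v c ∧ c ∈ subtree T r v ∧ u ∈ subtree T r c := by
  induction hd : T.dist r u using Nat.strong_induction_on generalizing u with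
  | _ d ih =>
    have hur : u ≠ r := by
      rintro rfl
      exact hne (eq_root_of_root_mem_subtree h)
    obtain ⟨p, hpu, hp⟩ := exists_parent hT hur
    have hvp := mem_subtree_of_parent h hne hpu
    by_cases hvp' : v = p
    · subst hvp'
      exact ⟨u, hpu, hp, self_mem_subtree T r u⟩
    · obtain ⟨c, h1, h2, h3⟩ := ih _ (hd ▸ dist_lt_of_mem_subtree hT.connected hp hpu.ne)
        hvp hvp' rfl
      exact ⟨c, h1, h2, subtree_trans h3 hp⟩

/-- Climb from `u` parent by parent: both `a` and `b` stay ancestors until one of them is reached.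
-/
theorem subtree_chain (hT : T.IsTree) {a b u : V} (ha : u ∈ subtree T r a)
    (hb : u ∈ subtree T r b) : b ∈ subtree T r a ∨ a ∈ subtree T r b := by
  induction hd : T.dist r u using Nat.strong_induction_on generalizing u with
  | _ d ih =>
    by_cases hau : a = u
    · subst hau; exact Or.inr hb
    by_cases hbu : b = u
    · subst hbu; exact Or.inl ha
    have hur : u ≠ r := by
      rintro rfl
      exact hau (eq_root_of_root_mem_subtree ha)
    obtain ⟨p, hpu, hp⟩ := exists_parent hT hur
    exact ih _ (hd ▸ dist_lt_of_mem_subtree hT.connected hp hpu.ne)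
      (mem_subtree_of_parent ha hau hpu) (mem_subtree_of_parent hb hbu hpu) rfl

/-- The children of `v` in the tree `T` rooted at `r`. -/
def childSet (T : SimpleGraph V) (r v : V) : Set V :=
  {c | T.Adj v c ∧ c ∈ subtree T r v}

theorem notMem_subtree_child (hT : T.IsTree) {v c : V} (hc : c ∈ childSet T r v) :
    v ∉ subtree T r c :=
  fun h => hc.1.ne (subtree_antisymm hT.connected hc.2 h)

/-- If one child lay below the other, then so would their common neighbour `v`. This makes the
subtrees of distinct children disjoint. -/
theorem child_unique (hT : T.IsTree) {v c c' u : V} (hc : c ∈ childSet T r v)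
    (hc' : c' ∈ childSet T r v) (h : u ∈ subtree T r c) (h' : u ∈ subtree T r c') : c = c' := by
  by_contra hne
  rcases subtree_chain hT h h' with h | h
  · exact notMem_subtree_child hT hc (mem_subtree_of_parent h hne hc'.1)
  · exact notMem_subtree_child hT hc' (mem_subtree_of_parent h (Ne.symm hne) hc.1)

/-- Supplies the single-edge hypothesis of `labelsOn_union`: a subtree is left only at its root, and
only towards the unique parent. -/
theorem eq_of_adj_of_mem_subtree (hT : T.IsTree) {v c x y : V} (hc : c ∈ childSet T r v)
    (hx : x ∈ subtree T r c) (hy : y ∉ subtree T r c) (hxy : T.Adj x y) : x = c ∧ y = v := by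
  have hyx : x ∈ subtree T r y := (mem_subtree_or_of_adj hT hxy).resolve_left
    fun h => hy (subtree_trans hx h)
  have hxc : c = x := by
    by_contra hne
    exact hy (mem_subtree_of_parent hx hne hxy.symm)
  subst hxc
  exact ⟨rfl, parent_unique hT hxy.symm hyx hc.1 hc.2⟩

/-- The vertex `v` together with the subtrees of the vertices in `D`. -/
def branch (T : SimpleGraph V) (r v : V) (D : Set V) : Set V :=
  insert v (⋃ c ∈ D, subtree T r c)

theorem branch_empty (v : V) : branch T r v ∅ = {v} := by simp [branch]

theorem branch_insert (v c : V) (D : Set V) :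
    branch T r v (insert c D) = branch T r v D ∪ subtree T r c := by
  ext x
  simp only [branch, Set.mem_insert_iff, Set.mem_iUnion, Set.mem_union, exists_prop]
  constructor
  · rintro (h | ⟨d, rfl | hd, h⟩)
    · exact Or.inl (Or.inl h)
    · exact Or.inr h
    · exact Or.inl (Or.inr ⟨d, hd, h⟩)
  · rintro ((h | ⟨d, hd, h⟩) | h)
    · exact Or.inl h
    · exact Or.inr ⟨d, Or.inr hd, h⟩
    · exact Or.inr ⟨c, Or.inl rfl, h⟩

theorem branch_childSet (hT : T.IsTree) (v : V) :
    branch T r v (childSet T r v) = subtree T r v := by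
  ext x
  simp only [branch, Set.mem_insert_iff, Set.mem_iUnion, exists_prop]
  constructor
  · rintro (rfl | ⟨c, hc, h⟩)
    · exact self_mem_subtree T r x
    · exact subtree_trans hc.2 h
  · intro h
    by_cases hx : v = x
    · exact Or.inl hx.symm
    · obtain ⟨c, h1, h2, h3⟩ := exists_child_of_mem_subtree hT h hx
      exact Or.inr ⟨c, ⟨h1, h2⟩, h3⟩

/-- The recursion that the algorithm executes. The order of the children is irrelevant, which is why
adjacency lists in any order will do. -/
theorem labelsOn_branch_insert [Finite V] (hT : T.IsTree) {v c : V} {D : Set V}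
    (hD : D ⊆ childSet T r v) (hc : c ∈ childSet T r v) (hcD : c ∉ D) :
    labelsOn T (branch T r v (insert c D)) v =
      joinLabels (labelsOn T (subtree T r c) c) (labelsOn T (branch T r v D) v) := by
  rw [branch_insert]
  have hdis : ∀ x ∈ branch T r v D, x ∉ subtree T r c := by
    intro x hx hxc
    simp only [branch, Set.mem_insert_iff, Set.mem_iUnion, exists_prop] at hx
    rcases hx with rfl | ⟨d, hd, h⟩
    · exact notMem_subtree_child hT hc hxc
    · exact hcD (child_unique hT hc (hD hd) hxc h ▸ hd)
  refine labelsOn_union (Set.mem_insert _ _) (self_mem_subtree T r c)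
    (Set.disjoint_left.2 hdis) hc.1 ?_
  intro x hx y hy hxy
  exact (eq_of_adj_of_mem_subtree hT hc hy (hdis x hx) hxy.symm).symm

theorem isInternal_of_adj [Finite V] {v a b : V} (ha : T.Adj v a) (hb : T.Adj v b)
    (hab : a ≠ b) : IsInternal T v := by
  have h : ({a, b} : Set V) ⊆ T.neighborSet v := by
    rintro x (rfl | rfl)
    · exact ha
    · exact hb
  have := Set.ncard_le_ncard h (Set.toFinite _)
  rwa [Set.ncard_pair hab] at this

theorem IsInternal.exists_adj_ne {v a : V} (h : IsInternal T v) : ∃ b, T.Adj v b ∧ b ≠ a := by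
  by_contra! hb
  have : T.neighborSet v ⊆ {a} := fun b hb' => hb b hb'
  have := Set.ncard_le_ncard this (Set.toFinite _)
  rw [Set.ncard_singleton] at this
  unfold IsInternal at h
  omega

theorem subtree_leaf [Finite V] (hT : T.IsTree) {v c : V} (hc : c ∈ childSet T r v)
    (hleaf : ¬ IsInternal T c) : subtree T r c = {c} := by
  ext x
  constructor
  · intro h
    by_contra hne
    obtain ⟨d, h1, h2, h3⟩ := exists_child_of_mem_subtree hT h (fun e => hne e.symm)
    refine hleaf (isInternal_of_adj h1 hc.1.symm ?_)
    rintro rfl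
    exact notMem_subtree_child hT hc h2
  · rintro rfl
    exact self_mem_subtree T r x

/-- A vertex other than the root has its parent besides the child `c`. For the root itself the
choice of an internal root is needed. -/
theorem isInternal_parent [Finite V] (hT : T.IsTree) (hr : IsInternal T r) {v c : V}
    (hc : c ∈ childSet T r v) : IsInternal T v := by
  by_cases hv : v = r
  · rwa [hv]
  · obtain ⟨p, hp, hpv⟩ := exists_parent hT hv
    refine isInternal_of_adj hc.1 hp.symm ?_
    rintro rfl
    exact notMem_subtree_child hT hc hpv

/-- If `c` were the parent of `v`, it would be internal. So leaves are recognised as children by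
their degree alone and need no number. -/
theorem leaf_mem_childSet [Finite V] (hT : T.IsTree) (hr : IsInternal T r) {v c : V}
    (hvc : T.Adj v c) (hleaf : ¬ IsInternal T c) : c ∈ childSet T r v := by
  refine ⟨hvc, (mem_subtree_or_of_adj hT hvc).resolve_right fun h => hleaf ?_⟩
  exact isInternal_parent hT hr ⟨hvc.symm, h⟩

/-- At most one of two neighbours is the parent. Hence a vertex without adjacent leaves does have a
first child to start from. -/
theorem childSet_nonempty (hT : T.IsTree) {v : V} (hv : IsInternal T v) :
    (childSet T r v).Nonempty := by
  obtain ⟨a, ha, -⟩ := hv.exists_adj_ne (a := v)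
  obtain ⟨b, hb, hab⟩ := hv.exists_adj_ne (a := a)
  rcases mem_subtree_or_of_adj (r := r) hT ha with h | h
  · exact ⟨a, ha, h⟩
  rcases mem_subtree_or_of_adj (r := r) hT hb with h' | h'
  · exact ⟨b, hb, h'⟩
  · exact absurd (parent_unique hT ha.symm h hb.symm h') hab.symm

/-- The labels of the centre of a star with `q` leaves. -/
def starLabels : ℕ → Set Label
  | 0 => {.neg1, .zero}
  | 1 => {.zero, .one}
  | 2 => {.zero, .two}
  | _ + 3 => {.zero}

/-- One more leaf: if the centre is chosen, the leaf is left out; otherwise the leaf must be chosen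
and raises the count of the centre. Three leaves exceed the bound two, so only 0 survives. -/
theorem joinLabels_starLabels (q : ℕ) :
    joinLabels {.neg1, .zero} (starLabels q) = starLabels (q + 1) := by
  ext l
  match q with
  | 0 | 1 | 2 | q + 3 => 
    cases l <;>
      simp only [joinLabels, Set.mem_ofPred_eq, twoGraphsTable, List.mem_cons, List.not_mem_nil,
        or_false, exists_eq_or_imp, exists_eq_left] <;>
      simp [starLabels]

theorem labelsOn_branch_leaves [Finite V] (hT : T.IsTree) {v : V} {D : Set V}
    (hD : D ⊆ childSet T r v) (hleaf : ∀ c ∈ D, ¬ IsInternal T c) :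
    labelsOn T (branch T r v D) v = starLabels D.ncard := by
  induction D, D.toFinite using Set.Finite.induction_on with
  | empty => rw [branch_empty, labelsOn_singleton, Set.ncard_empty]; rfl
  | @insert c D hc _ ih =>
    have hD' := (Set.subset_insert c D).trans hD
    have hcc := hD (Set.mem_insert c D)
    rw [labelsOn_branch_insert hT hD' hcc hc, ih hD' fun d hd => hleaf d (Or.inr hd),
      subtree_leaf hT hcc (hleaf c (Or.inl rfl)), labelsOn_singleton, joinLabels_starLabels,
      Set.ncard_insert_of_notMem hc]

/-- Every vertex of the subtree other than `v` has all its neighbours there, so its count is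
unchanged. The count of `v` can only drop, and type I allows this. -/
theorem isTypeIOn_subtree (v : V) {S : Set V} [Finite V]
    (hS : IsIndepOneTwoSet T S) :
    IsTypeIOn T (subtree T r v) v (S ∩ subtree T r v) := by
  have hle : nbrCount T (S ∩ subtree T r v) v ≤ nbrCount T S v :=
    Set.ncard_le_ncard (Set.inter_subset_inter_right _ Set.inter_subset_left) (Set.toFinite _)
  refine ⟨Set.inter_subset_right, hS.1.mono Set.inter_subset_left, ?_, ?_⟩
  · intro u hu huS hne
    have hc : nbrCount T (S ∩ subtree T r v) u = nbrCount T S u := by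
      unfold nbrCount
      congr 1
      ext w
      simp only [Set.mem_inter_iff, SimpleGraph.mem_neighborSet]
      refine ⟨fun h => ⟨h.1, h.2.1⟩, fun h => ⟨h.1, h.2, ?_⟩⟩
      exact mem_subtree_of_parent hu hne.symm h.1.symm
    rw [hc]
    exact hS.2 u fun h => huS ⟨h, hu⟩
  · intro hv
    exact hle.trans (hS.2 v fun h => hv ⟨h, self_mem_subtree T r v⟩).2

theorem labelsOn_subtree_nonempty [Finite V] (v : V) {S : Set V}
    (hS : IsIndepOneTwoSet T S) : (labelsOn T (subtree T r v) v).Nonempty := by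
  have h := isTypeIOn_subtree (r := r) v hS
  obtain ⟨l, hl⟩ := exists_hasLabelOn h
  exact ⟨l, _, h, hl⟩

theorem exists_isIndepOneTwoSet_iff [Finite V] :
    (∃ S, IsIndepOneTwoSet T S) ↔ .zero ∈ labelsOn T (subtree T r r) r ∨
      .one ∈ labelsOn T (subtree T r r) r ∨ .two ∈ labelsOn T (subtree T r r) r := by
  have hu : subtree T r r = Set.univ := Set.eq_univ_of_forall fun v => mem_subtree_root v
  constructor
  · rintro ⟨S, hS⟩
    have h := isTypeIOn_subtree (r := r) r hS
    rw [hu, Set.inter_univ] at h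
    rw [hu]
    by_cases hr : r ∈ S
    · exact Or.inl ⟨S, h, hr⟩
    · have := hS.2 r hr
      have h3 : nbrCount T S r = 1 ∨ nbrCount T S r = 2 := by omega
      exact Or.inr (h3.imp (fun h3 => ⟨S, h, hr, h3⟩) (fun h3 => ⟨S, h, hr, h3⟩))
  · rw [hu]
    have key : ∀ S, IsTypeIOn T Set.univ r S →
        (r ∉ S → nbrCount T S r = 1 ∨ nbrCount T S r = 2) → IsIndepOneTwoSet T S := by
      intro S hS h
      refine ⟨hS.2.1, fun u hu' => ?_⟩
      by_cases hur : u = r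
      · subst hur
        have := h hu'
        omega
      · exact hS.2.2.1 u (Set.mem_univ u) hu' hur
    rintro (⟨S, hS, h⟩ | ⟨S, hS, h⟩ | ⟨S, hS, h⟩)
    · exact ⟨S, key S hS fun h' => absurd h h'⟩
    · exact ⟨S, key S hS fun _ => Or.inl h.2⟩
    · exact ⟨S, key S hS fun _ => Or.inr h.2⟩

/-- A parent of `u` other than `r` would be adjacent both to `u` and to its own parent, hence
internal. -/
theorem adj_of_no_internal [Finite V] (hT : T.IsTree) (h : ∀ v, ¬ IsInternal T v) {u r : V}
    (hu : u ≠ r) : T.Adj u r := by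
  obtain ⟨p, hp, hpu⟩ := exists_parent (r := r) hT hu
  by_cases hpr : p = r
  · exact hpr ▸ hp.symm
  · obtain ⟨q, hq, hqp⟩ := exists_parent hT hpr
    refine absurd (isInternal_of_adj hp hq.symm ?_) (h p)
    rintro rfl
    exact hp.ne (subtree_antisymm hT.connected hpu hqp)

theorem exists_isIndepOneTwoSet_of_no_internal [Finite V] (hT : T.IsTree)
    (h : ∀ v, ¬ IsInternal T v) : ∃ S, IsIndepOneTwoSet T S := by
  obtain ⟨r⟩ := hT.connected.nonempty
  refine ⟨{r}, by simp [SimpleGraph.IsIndepSet], fun u hu => ?_⟩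
  have : T.neighborSet u ∩ {r} = {r} := by
    rw [Set.inter_eq_right, Set.singleton_subset_iff]
    exact adj_of_no_internal hT h hu
  simp [nbrCount, this]

theorem exists_isInternal [Finite V] (hT : T.IsTree) (h : 3 ≤ Nat.card V) :
    ∃ v, IsInternal T v := by
  by_contra! hn
  obtain ⟨r⟩ := hT.connected.nonempty
  apply hn r
  have hs : {r}ᶜ ⊆ T.neighborSet r := fun u hu => (adj_of_no_internal hT hn hu).symm
  have h1 := Set.ncard_le_ncard hs (Set.toFinite _)
  have h2 := Set.ncard_add_ncard_compl {r}
  rw [Set.ncard_singleton] at h2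
  unfold IsInternal
  omega

end Trees

/-! ### Semantics of the machine: loop invariants, unchanged memory, step bounds -/

section Machine

variable {A : Input}

@[simp] theorem State.setVar_var_self (s : State) (x : Var) (a : ℕ) : (s.setVar x a).var x = a := by
  simp [State.setVar]

theorem State.setVar_var (s : State) (x y : Var) (a : ℕ) :
    (s.setVar x a).var y = if y = x then a else s.var y := by
  simp [State.setVar, Function.update_apply]

@[simp] theorem State.setVar_arr (s : State) (x : Var) (a : ℕ) : (s.setVar x a).arr = s.arr := rfl

@[simp] theorem State.setArr_var (s : State) (b : Arr) (i a : ℕ) : (s.setArr b i a).var = s.var :=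
  rfl

theorem State.setArr_arr (s : State) (b b' : Arr) (i j a : ℕ) :
    (s.setArr b i a).arr b' j = if b' = b ∧ j = i then a else s.arr b' j := by
  by_cases h : b' = b
  · subst h
    simp [State.setArr, Function.update_apply]
  · simp [State.setArr, h]

theorem Cmd.run_set (x : Var) (e : Expr) (s : State) :
    ((Cmd.set x e).run A s).1 = s.setVar x (e.eval A s) := rfl

theorem Cmd.run_store (b : Arr) (i e : Expr) (s : State) :
    ((Cmd.store b i e).run A s).1 = s.setArr b (i.eval A s) (e.eval A s) := rfl

theorem Cmd.run_ite (b : Cond) (c d : Cmd) (s : State) :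
    ((Cmd.ite b c d).run A s).1 = if b.eval A s = true then (c.run A s).1 else (d.run A s).1 := rfl

theorem Cmd.run_block_nil (s : State) : ((Cmd.block []).run A s).1 = s := rfl

theorem Cmd.run_block_cons (c : Cmd) (cs : List Cmd) (s : State) :
    ((Cmd.block (c :: cs)).run A s).1 = ((Cmd.block cs).run A (c.run A s).1).1 := rfl

theorem Cmd.run_when (b : Cond) (cs : List Cmd) (s : State) :
    ((Cmd.when b cs).run A s).1 =
      if b.eval A s = true then ((Cmd.block cs).run A s).1 else s := rfl

/-- The invariant also sees the steps spent so far. The breadth-first search needs this, since its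
cost is charged to a queue that is still growing. -/
theorem Cmd.run_loop_inv {x : Var} {e : Expr} {c : Cmd} {s : State} (J : ℕ → State → ℕ → Prop)
    (h0 : J 0 s (e.cost + 1))
    (hstep : ∀ m < e.eval A s, ∀ t k, J m t k →
      J (m + 1) (c.run A (t.setVar x m)).1 (k + (c.run A (t.setVar x m)).2 + 1)) :
    J (e.eval A s) ((Cmd.loop x e c).run A s).1 ((Cmd.loop x e c).run A s).2 := by
  suffices h : ∀ N ≤ e.eval A s, ∀ p : State × ℕ, p = (List.range N).foldl
        (fun p m => ((c.run A (p.1.setVar x m)).1, p.2 + (c.run A (p.1.setVar x m)).2 + 1))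
        (s, e.cost + 1) → J N p.1 p.2 from h _ le_rfl _ rfl
  intro N hN
  induction N with
  | zero => rintro p rfl; exact h0
  | succ N ih =>
    rintro p rfl
    rw [List.range_succ, List.foldl_append]
    exact hstep N (by omega) _ _ (ih (by omega) _ rfl)

theorem Cmd.run_loop {x : Var} {e : Expr} {c : Cmd} {s : State} (I : ℕ → State → Prop)
    (f : ℕ → ℕ) (h0 : I 0 s)
    (hstep : ∀ m < e.eval A s, ∀ t, I m t → I (m + 1) (c.run A (t.setVar x m)).1 ∧
      (c.run A (t.setVar x m)).2 ≤ f m) :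
    I (e.eval A s) ((Cmd.loop x e c).run A s).1 ∧
      ((Cmd.loop x e c).run A s).2 ≤ e.cost + 1 + ∑ m ∈ Finset.range (e.eval A s), (f m + 1) := by
  refine Cmd.run_loop_inv
    (J := fun N t k => I N t ∧ k ≤ e.cost + 1 + ∑ m ∈ Finset.range N, (f m + 1))
    ⟨h0, by simp⟩ fun m hm t k ⟨h1, h2⟩ => ?_
  obtain ⟨h3, h4⟩ := hstep m hm t h1
  rw [Finset.sum_range_succ]
  exact ⟨h3, by omega⟩

theorem Cmd.run_loop_state {x : Var} {e : Expr} {c : Cmd} {s : State} (I : ℕ → State → Prop)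
    (h0 : I 0 s)
    (hstep : ∀ m < e.eval A s, ∀ t, I m t → I (m + 1) (c.run A (t.setVar x m)).1) :
    I (e.eval A s) ((Cmd.loop x e c).run A s).1 :=
  Cmd.run_loop_inv (J := fun N t _ => I N t) h0 fun m hm t _ h => hstep m hm t h

/-- The command assigns to the register. -/
def Cmd.writes (y : Var) : Cmd → Bool
  | .skip => false
  | .set x _ => decide (x = y)
  | .store _ _ _ => false
  | .seq c d => c.writes y || d.writes y
  | .ite _ c d => c.writes y || d.writes y
  | .loop x _ c => decide (x = y) || c.writes y

/-- The command stores to the array. -/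
def Cmd.stores (a : Arr) : Cmd → Bool
  | .skip => false
  | .set _ _ => false
  | .store b _ _ => decide (b = a)
  | .seq c d => c.stores a || d.stores a
  | .ite _ c d => c.stores a || d.stores a
  | .loop _ _ c => c.stores a

/-- A frame rule with a syntactic premise: for the fixed programs below, `decide` discharges it. -/
theorem Cmd.run_var {y : Var} {c : Cmd} (h : c.writes y = false) (s : State) :
    (c.run A s).1.var y = s.var y := by
  induction c generalizing s with
  | skip => rfl
  | set x e =>
    simp only [Cmd.writes, decide_eq_false_iff_not] at h
    rw [Cmd.run_set, State.setVar_var, if_neg (Ne.symm h)]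
  | store b i e => rfl
  | seq c d ihc ihd =>
    simp only [Cmd.writes, Bool.or_eq_false_iff] at h
    exact (ihd h.2 _).trans (ihc h.1 _)
  | ite b c d ihc ihd =>
    simp only [Cmd.writes, Bool.or_eq_false_iff] at h
    rw [Cmd.run_ite]
    split_ifs
    · exact ihc h.1 _
    · exact ihd h.2 _
  | loop x e c ih =>
    simp only [Cmd.writes, Bool.or_eq_false_iff, decide_eq_false_iff_not] at h
    refine Cmd.run_loop_state (I := fun _ t => t.var y = s.var y) rfl fun m _ t ht => ?_
    rw [ih h.2, State.setVar_var, if_neg (Ne.symm h.1), ht]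

theorem Cmd.run_arr {a : Arr} {c : Cmd} (h : c.stores a = false) (s : State) :
    (c.run A s).1.arr a = s.arr a := by
  induction c generalizing s with
  | skip => rfl
  | set x e => rfl
  | store b i e =>
    simp only [Cmd.stores, decide_eq_false_iff_not] at h
    funext j
    rw [Cmd.run_store, State.setArr_arr, if_neg (fun hh => h hh.1.symm)]
  | seq c d ihc ihd =>
    simp only [Cmd.stores, Bool.or_eq_false_iff] at h
    exact (ihd h.2 _).trans (ihc h.1 _)
  | ite b c d ihc ihd =>
    simp only [Cmd.stores, Bool.or_eq_false_iff] at h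
    rw [Cmd.run_ite]
    split_ifs
    · exact ihc h.1 _
    · exact ihd h.2 _
  | loop x e c ih =>
    simp only [Cmd.stores] at h
    refine Cmd.run_loop_state (I := fun _ t => t.arr a = s.arr a) rfl fun m _ t ht => ?_
    rw [ih h, State.setVar_arr, ht]

/-- The command contains no loop. -/
def Cmd.flat : Cmd → Bool
  | .skip => true
  | .set _ _ => true
  | .store _ _ _ => true
  | .seq c d => c.flat && d.flat
  | .ite _ c d => c.flat && d.flat
  | .loop _ _ _ => false

/-- The command does not assign to the register `y`, and its loops are not nested and run over the
positions of the adjacency list of the vertex in `y`. -/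
def Cmd.scans (y : Var) : Cmd → Bool
  | .loop x (.deg (.var z)) c => decide (z = y) && !decide (x = y) && c.flat && !c.writes y
  | .loop _ _ _ => false
  | .seq c d => c.scans y && d.scans y && !c.writes y
  | .ite _ c d => c.scans y && d.scans y
  | _ => true

/-- A bound for the number of steps without the iterations of the loops. -/
def Cmd.base : Cmd → ℕ
  | .skip => 1
  | .set _ e => e.cost + 1
  | .store _ i e => i.cost + e.cost + 1
  | .seq c d => c.base + d.base + 1
  | .ite b c d => b.cost + (c.base + d.base) + 1
  | .loop _ e _ => e.cost + 1

/-- A bound for the number of steps of one iteration of all loops. -/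
def Cmd.slope : Cmd → ℕ
  | .seq c d => c.slope + d.slope
  | .ite _ c d => c.slope + d.slope
  | .loop _ _ c => c.base + 1
  | _ => 0

theorem Cmd.cost_le_of_flat {c : Cmd} (h : c.flat = true) (s : State) :
    (c.run A s).2 ≤ c.base := by
  induction c generalizing s with
  | skip => exact le_rfl
  | set x e => exact le_rfl
  | store b i e => exact le_rfl
  | seq c d ihc ihd =>
    simp only [Cmd.flat, Bool.and_eq_true] at h
    have h1 := ihc h.1 s
    have h2 := ihd h.2 (c.run A s).1
    simp only [Cmd.run, Cmd.base]
    omega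
  | ite b c d ihc ihd =>
    simp only [Cmd.flat, Bool.and_eq_true] at h
    have h1 := ihc h.1 s
    have h2 := ihd h.2 s
    simp only [Cmd.run, Cmd.base]
    split_ifs <;> omega
  | loop x e c ih => simp [Cmd.flat] at h

/-- No command changes `y` before a later loop reads it, so all loops have the same number of
iterations, namely the degree of the vertex in `y`. Each loop body is free of loops and costs at
most a constant. -/
theorem Cmd.cost_le_of_scans {y : Var} {c : Cmd} (h : c.scans y = true) (s : State) :
    (c.run A s).2 ≤ c.base + c.slope * (A.adj (s.var y)).length := by
  induction c generalizing s with
  | skip => exact Nat.le_add_right _ _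
  | set x e => exact Nat.le_add_right _ _
  | store b i e => exact Nat.le_add_right _ _
  | seq c d ihc ihd =>
    simp only [Cmd.scans, Bool.and_eq_true, Bool.not_eq_true'] at h
    have h1 := ihc h.1.1 s
    have h2 := ihd h.1.2 (c.run A s).1
    rw [Cmd.run_var h.2] at h2
    simp only [Cmd.run, Cmd.base, Cmd.slope, add_mul]
    omega
  | ite b c d ihc ihd =>
    simp only [Cmd.scans, Bool.and_eq_true] at h
    have h1 := ihc h.1 s
    have h2 := ihd h.2 s
    simp only [Cmd.run, Cmd.base, Cmd.slope, add_mul]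
    split_ifs <;> omega
  | loop x e c ih =>
    unfold Cmd.scans at h
    split at h
    next z c heq =>
      injection heq with h1 h2 h3
      subst h1 h2 h3
      simp only [Bool.and_eq_true, Bool.not_eq_true', decide_eq_true_eq,
        decide_eq_false_iff_not] at h
      obtain ⟨⟨⟨rfl, -⟩, hf⟩, -⟩ := h
      have := (Cmd.run_loop (A := A) (x := x) (e := .deg (.var z)) (c := c) (s := s)
        (fun _ _ => True) (fun _ => c.base) trivial
        fun m _ t _ => ⟨trivial, Cmd.cost_le_of_flat hf _⟩).2
      simp only [Finset.sum_const, Finset.card_range, smul_eq_mul] at this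
      simp only [Cmd.base, Cmd.slope]
      rw [mul_comm (c.base + 1)]
      exact this
    all_goals simp_all

theorem Cond.eval_eq (e f : Expr) (s : State) :
    (Cond.eq e f).eval A s = true ↔ e.eval A s = f.eval A s := decide_eq_true_iff

theorem Cond.eval_lt (e f : Expr) (s : State) :
    (Cond.lt e f).eval A s = true ↔ e.eval A s < f.eval A s := decide_eq_true_iff

theorem Cond.eval_not (b : Cond) (s : State) :
    (Cond.not b).eval A s = true ↔ ¬ b.eval A s = true := by
  simp [Cond.eval]

theorem Cond.eval_and (b c : Cond) (s : State) :
    (Cond.and b c).eval A s = true ↔ b.eval A s = true ∧ c.eval A s = true := by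
  simp [Cond.eval]

theorem Cond.eval_any (bs : List Cond) (s : State) :
    (Cond.any bs).eval A s = true ↔ ∃ b ∈ bs, b.eval A s = true := by
  induction bs with
  | nil => simp [Cond.any, Cond.eval]
  | cons b bs ih => simp [Cond.any, Cond.eval, ih]

/-- The list of the vertex `w` in the memory `s`. -/
def listAt (s : State) (w : ℕ) : Set Label := {l | s.arr (.R l) w = 1}

theorem labelList_eq (s : State) (w : ℕ) : labelList s w = Label.toInt '' listAt s w := by
  ext k
  simp only [labelList, listAt, Set.mem_image, Set.mem_ofPred_eq, and_comm]

theorem eval_hasLabel (l : Label) (e : Expr) (s : State) :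
    (hasLabel l e).eval A s = true ↔ l ∈ listAt s (e.eval A s) := by
  exact Cond.eval_eq _ _ _

theorem Label.mem_all (l : Label) : l ∈ Label.all := by cases l <;> simp [Label.all]

theorem eval_any_hasLabel (e : Expr) (s : State) :
    (Cond.any (Label.all.map fun l => hasLabel l e)).eval A s = true ↔
      (listAt s (e.eval A s)).Nonempty := by
  rw [Cond.eval_any]
  constructor
  · rintro ⟨b, hb, h⟩
    obtain ⟨l, -, rfl⟩ := List.mem_map.1 hb
    exact ⟨l, (eval_hasLabel l e s).1 h⟩
  · rintro ⟨l, h⟩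
    exact ⟨_, List.mem_map.2 ⟨l, l.mem_all, rfl⟩, (eval_hasLabel l e s).2 h⟩

theorem eval_twoGraphsRule (l : Label) (s : State) :
    (twoGraphsRule l).eval A s = true ↔
      l ∈ joinLabels (listAt s (s.var .u)) (listAt s (s.var .v)) := by
  simp only [twoGraphsRule, Cond.eval_any, List.mem_map, joinLabels, Set.mem_ofPred_eq]
  constructor
  · rintro ⟨_, ⟨p, hp, rfl⟩, h⟩
    simp only [Cond.eval, Bool.and_eq_true, eval_hasLabel] at h
    exact ⟨p, hp, h⟩
  · rintro ⟨p, hp, h⟩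
    refine ⟨_, ⟨p, hp, rfl⟩, ?_⟩
    simp only [Cond.eval, Bool.and_eq_true, eval_hasLabel]
    exact h

/-- The one-vertex table is the part of the join table in which `v` is still a single vertex, with
labels -1 and 0. -/
theorem eval_oneVertexRule (l : Label) (s : State) :
    (oneVertexRule l).eval A s = true ↔
      l ∈ joinLabels (listAt s (s.var .u)) {.neg1, .zero} := by
  simp only [oneVertexRule, Cond.eval_any, List.mem_map, joinLabels, Set.mem_ofPred_eq]
  have h1 : (∃ b, (∃ a ∈ oneVertexTable l, hasLabel a (.var .u) = b) ∧ b.eval A s = true) ↔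
      ∃ a ∈ oneVertexTable l, a ∈ listAt s (s.var .u) := by
    constructor
    · rintro ⟨_, ⟨a, ha, rfl⟩, h⟩
      exact ⟨a, ha, (eval_hasLabel _ _ _).1 h⟩
    · rintro ⟨a, ha, h⟩
      exact ⟨_, ⟨a, ha, rfl⟩, (eval_hasLabel _ _ _).2 h⟩
  rw [h1]
  generalize listAt s (s.var .u) = P
  cases l <;> simp only [oneVertexTable, twoGraphsTable, List.mem_cons, List.not_mem_nil,
        or_false, exists_eq_or_imp, exists_eq_left] <;> simp

theorem eval_starRule (l : Label) (s : State) (h : 0 < s.var .leaves) :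
    (starRule l).eval A s = true ↔ l ∈ starLabels (s.var .leaves) := by
  have : (starRule l).eval A s = true ↔ match l with
    | .zero => True
    | .one => s.var .leaves = 1
    | .two => s.var .leaves = 2
    | _ => False := by
    cases l <;> simp [starRule, Cond.eval_eq, Expr.eval] <;> simp [Cond.eval]
  rw [this]
  generalize s.var .leaves = q at h
  match q, h with
  | 1, _ | 2, _ | q + 3, _ => cases l <;> simp [starLabels]

/-- The value of the condition does not depend on the registers `tmp`. -/
def Cond.IgnoresTmp (b : Cond) : Prop :=
  ∀ (A : Input) (l : Label) (a : ℕ) (s : State), b.eval A (s.setVar (.tmp l) a) = b.eval A s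

theorem ignoresTmp_starRule (l : Label) : (starRule l).IgnoresTmp := by
  intro A l' a s
  rw [Bool.eq_iff_iff]
  cases l <;> simp [starRule, Cond.eval_eq, Expr.eval, State.setVar_var] <;> simp [Cond.eval]

theorem ignoresTmp_twoGraphsRule (l : Label) : (twoGraphsRule l).IgnoresTmp := by
  intro A l' a s
  rw [Bool.eq_iff_iff, eval_twoGraphsRule, eval_twoGraphsRule]
  simp [State.setVar_var, listAt]

theorem ignoresTmp_oneVertexRule (l : Label) : (oneVertexRule l).IgnoresTmp := by
  intro A l' a s
  rw [Bool.eq_iff_iff, eval_oneVertexRule, eval_oneVertexRule]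
  simp [State.setVar_var, listAt]

theorem run_ite_set (b : Cond) (x : Var) (s : State) :
    ((Cmd.ite b (.set x (.const 1)) (.set x (.const 0))).run A s).1 =
      s.setVar x (if b.eval A s = true then 1 else 0) := by
  rw [Cmd.run_ite]
  split_ifs <;> rfl

/-- All five tests are evaluated into the registers `tmp` before any list cell is overwritten, so
each test sees the old list of `v`. The premise `hf` keeps the earlier assignments from influencing
the later tests. -/
theorem run_actualize {f : Label → Cond} (hf : ∀ l, (f l).IgnoresTmp) (s : State) (l : Label)
    (w : ℕ) : ((actualize f).run A s).1.arr (.R l) w =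
      if w = s.var .v then (if (f l).eval A s = true then 1 else 0) else s.arr (.R l) w := by
  have hf' := fun l l' a s => hf l A l' a s
  simp only [actualize, Label.all, List.map_cons, List.map_nil, List.cons_append, List.nil_append,
    Cmd.run_block_cons, Cmd.run_block_nil, run_ite_set, Cmd.run_store, hf', Expr.eval,
    State.setArr_arr, State.setArr_var, State.setVar_arr, State.setVar_var]
  cases l <;> simp

theorem listAt_actualize {f : Label → Cond} (hf : ∀ l, (f l).IgnoresTmp) (s : State) :
    listAt ((actualize f).run A s).1 (s.var .v) = {l | (f l).eval A s = true} := by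
  ext l
  simp [listAt, run_actualize hf]

theorem listAt_actualize_ne {f : Label → Cond} (hf : ∀ l, (f l).IgnoresTmp) (s : State) {w : ℕ}
    (hw : w ≠ s.var .v) : listAt ((actualize f).run A s).1 w = listAt s w := by
  ext l
  simp [listAt, run_actualize hf, hw]

end Machine

/-! ### Reading the tree from its adjacency lists -/

section AdjacencyLists

variable {n : ℕ} {T : SimpleGraph (Fin n)} {A : Input}

/-- The vertices in the first `m` positions of the adjacency list of `v`. -/
def seen (n : ℕ) (A : Input) (v m : ℕ) : Set (Fin n) := {c | (c : ℕ) ∈ (A.adj v).take m}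

theorem seen_zero (v : ℕ) : seen n A v 0 = ∅ := by simp [seen]

theorem Input.Represents.seen_length (hA : A.Represents T) (v : Fin n) :
    seen n A v (A.adj v).length = T.neighborSet v := by
  ext c
  simp [seen, (hA.2 v).2]

/-- One iteration over an adjacency list: as the list has no repetitions, the entry read is a
neighbour not met before. -/
theorem Input.Represents.exists_nbr (hA : A.Represents T) (v : Fin n) {m : ℕ}
    (hm : m < (A.adj v).length) : ∃ c : Fin n, (A.adj v).getD m 0 = c ∧ T.Adj v c ∧
      c ∉ seen n A v m ∧ seen n A v (m + 1) = insert c (seen n A v m) := by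
  obtain ⟨hlt, hadj⟩ := ((hA.2 v).2 _).1 (List.getElem_mem hm)
  have ht : (A.adj v).take (m + 1) = (A.adj v).take m ++ [(A.adj v)[m]] :=
    List.take_succ_eq_append_getElem hm
  refine ⟨⟨(A.adj v)[m], hlt⟩, by simp [hm], hadj, ?_, ?_⟩
  · have hnd := (hA.2 v).1.sublist (List.take_sublist (m + 1) _)
    rw [ht] at hnd
    intro h
    exact (List.nodup_append.1 hnd).2.2 _ h _ (List.mem_singleton_self _) rfl
  · ext c
    simp only [seen, ht, List.mem_append, List.mem_singleton, Set.mem_ofPred_eq,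
      Set.mem_insert_iff, Fin.ext_iff]
    exact or_comm

theorem Input.Represents.length_adj (hA : A.Represents T) (v : Fin n) :
    (A.adj v).length = (T.neighborSet v).ncard := by
  rw [← List.toFinset_card_of_nodup (hA.2 v).1, ← Set.ncard_coe_finset,
    ← Set.ncard_image_of_injective _ Fin.val_injective]
  congr 1
  ext w
  simp only [List.coe_toFinset, Set.mem_ofPred_eq, (hA.2 v).2, Set.mem_image,
    SimpleGraph.mem_neighborSet]
  exact ⟨fun ⟨h, h'⟩ => ⟨_, h', rfl⟩, by rintro ⟨x, h, rfl⟩; exact ⟨x.2, h⟩⟩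

theorem Input.Represents.eval_internalTest (hA : A.Represents T) {e : Expr} {s : State}
    {v : Fin n} (he : e.eval A s = v) : (internalTest e).eval A s = true ↔ IsInternal T v := by
  rw [internalTest, Cond.eval_lt]
  simp only [Expr.eval, he, hA.length_adj]
  rfl

/-- Distinct vertices contribute at most the full degree sum, which is twice the number `n - 1` of
edges. -/
theorem Input.Represents.sum_length_le (hA : A.Represents T) (hT : T.IsTree) {k : ℕ} {q : ℕ → ℕ}
    (hq : ∀ i < k, q i < n) (hinj : ∀ i < k, ∀ j < k, q i = q j → i = j) :
    ∑ i ∈ Finset.range k, (A.adj (q i)).length ≤ 2 * n := by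
  classical
  have hinj' : Set.InjOn q (Finset.range k) := fun i hi j hj h =>
    hinj i (by simpa using hi) j (by simpa using hj) h
  rw [← Finset.sum_image (f := fun v => (A.adj v).length) hinj']
  have hsub : (Finset.range k).image q ⊆ Finset.range n := by
    intro x hx
    obtain ⟨i, hi, rfl⟩ := Finset.mem_image.1 hx
    exact Finset.mem_range.2 (hq i (Finset.mem_range.1 hi))
  refine (Finset.sum_le_sum_of_subset hsub).trans ?_
  rw [Finset.sum_range]
  have h1 : ∀ v : Fin n, (A.adj v).length = T.degree v := fun v => by
    rw [hA.length_adj, Set.ncard_eq_toFinset_card', ← SimpleGraph.card_neighborFinset_eq_degree]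
    rfl
  simp only [h1]
  rw [SimpleGraph.sum_degrees_eq_twice_card_edges]
  have := hT.card_edgeFinset
  rw [Fintype.card_fin] at this
  omega

end AdjacencyLists

/-! ### Computing the list of one vertex -/

section ProcessVertex

variable {n : ℕ} {T : SimpleGraph (Fin n)} {A : Input} {r : Fin n}

/-- The loop of `processVertex` that counts the leaves adjacent to the current vertex. -/
def countLeaves : Cmd := .loop .j (.deg (.var .v)) (.block [
  .set .u (.nbr (.var .v) (.var .j)),
  .when (.not (internalTest (.var .u))) [.set .leaves (.succ (.var .leaves))]])

/-- The loop of `processVertex` that adds the internal children to a star. -/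
def addToStar : Cmd := .loop .j (.deg (.var .v)) (.block [
  .set .u (.nbr (.var .v) (.var .j)),
  .when (.and (internalTest (.var .u)) childTest) [actualize twoGraphsRule]])

/-- The loop of `processVertex` that adds the children when all of them are internal. -/
def addToCentre : Cmd := .loop .j (.deg (.var .v)) (.block [
  .set .u (.nbr (.var .v) (.var .j)),
  .when childTest [
    .ite (.eq (.var .picked) (.const 0))
      (.block [actualize oneVertexRule, .set .picked (.const 1)])
      (actualize twoGraphsRule)]])

theorem processVertex_eq : processVertex = .block [
    .set .leaves (.const 0),
    countLeaves,
    .ite (.lt (.const 0) (.var .leaves))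
      (.block [actualize starRule, addToStar])
      (.block [.set .picked (.const 0), addToCentre])] := rfl

theorem listAt_congr {s t : State} (h : ∀ l, t.arr (.R l) = s.arr (.R l)) (w : ℕ) :
    listAt t w = listAt s w := by
  ext l
  simp [listAt, h]

theorem listAt_setVar (s : State) (x : Var) (a w : ℕ) :
    listAt (s.setVar x a) w = listAt s w := rfl

theorem run_countLeaves (hA : A.Represents T) {v : Fin n} {s : State} (hv : s.var .v = v)
    (h0 : s.var .leaves = 0) : (countLeaves.run A s).1.var .leaves =
      ({c | T.Adj v c ∧ ¬ IsInternal T c} : Set (Fin n)).ncard := by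
  have key := Cmd.run_loop_state (A := A) (x := .j) (e := .deg (.var .v)) (s := s)
    (c := .block [.set .u (.nbr (.var .v) (.var .j)),
      .when (.not (internalTest (.var .u))) [.set .leaves (.succ (.var .leaves))]])
    (I := fun m t => t.var .v = v ∧
      t.var .leaves = (seen n A v m ∩ {c | ¬ IsInternal T c}).ncard)
    ⟨hv, by simp [seen_zero, h0]⟩ ?_
  · have hd : (Expr.deg (.var .v)).eval A s = (A.adj v).length := by simp [Expr.eval, hv]
    rw [hd, hA.seen_length] at key
    exact key.2
  · rintro m hm t ⟨htv, htl⟩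
    simp only [Expr.eval, hv] at hm
    obtain ⟨c, hc, hvc, hnot, hseen⟩ := hA.exists_nbr v hm
    have hu : ((t.setVar .j m).setVar .u c).var .u = c := by simp
    simp only [Cmd.run_block_cons, Cmd.run_block_nil, Cmd.run_set, Cmd.run_when, Expr.eval,
      State.setVar_var, if_true, if_false, reduceCtorEq, htv, hc, hseen]
    have hev := hA.eval_internalTest (e := .var .u) (s := (t.setVar .j m).setVar .u c)
      (v := c) (by simp [Expr.eval])
    rw [← not_iff_not, ← Cond.eval_not] at hev
    by_cases hi : ¬ IsInternal T c
    · rw [if_pos (hev.2 hi), Set.insert_inter_of_mem (show c ∈ {c | ¬ IsInternal T c} from hi),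
        Set.ncard_insert_of_notMem fun h => hnot h.1]
      simp [State.setVar_var, htv, htl]
    · rw [if_neg fun h => hi (hev.1 h),
        Set.insert_inter_of_notMem (show c ∉ {c | ¬ IsInternal T c} from hi)]
      simp [State.setVar_var, htv, htl]

/-- The numbers tell which internal neighbours of `v` are its children, and the lists of the
internal children of `v` are correct. -/
structure ReadyAt (T : SimpleGraph (Fin n)) (r v : Fin n) (s : State) : Prop where
  var_v : s.var .v = v
  lab_lt_iff : ∀ c, T.Adj v c → IsInternal T c →
    (s.arr .lab c < s.arr .lab v ↔ c ∈ childSet T r v)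
  listAt_child : ∀ c ∈ childSet T r v, IsInternal T c →
    listAt s c = labelsOn T (subtree T r c) c

/-- The lists that matter are those of children, never that of `v`, so the property survives every
update of the list of `v`. -/
theorem ReadyAt.of_eq {v : Fin n} {s t : State} (h : ReadyAt T r v s) (hv : t.var .v = s.var .v)
    (hlab : t.arr .lab = s.arr .lab) (hR : ∀ w ≠ (v : ℕ), listAt t w = listAt s w) :
    ReadyAt T r v t where
  var_v := hv.trans h.var_v
  lab_lt_iff := by rw [hlab]; exact h.lab_lt_iff
  listAt_child c hc hi := by
    rw [hR c fun e => hc.1.ne (Fin.ext e.symm)]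
    exact h.listAt_child c hc hi

theorem ReadyAt.eval_childTest {v c : Fin n} {s : State} (h : ReadyAt T r v s)
    (hu : s.var .u = c) (hc : T.Adj v c) (hi : IsInternal T c) :
    childTest.eval A s = true ↔ c ∈ childSet T r v := by
  rw [childTest, Cond.eval_lt]
  simp only [Expr.eval, hu, h.var_v]
  exact h.lab_lt_iff c hc hi

theorem ReadyAt.run_twoGraphs (hT : T.IsTree) {v c : Fin n} {s : State} {D : Set (Fin n)}
    (h : ReadyAt T r v s) (hu : s.var .u = c) (hi : IsInternal T c) (hc : c ∈ childSet T r v)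
    (hD : D ⊆ childSet T r v) (hcD : c ∉ D)
    (hl : listAt s v = labelsOn T (branch T r v D) v) :
    listAt ((actualize twoGraphsRule).run A s).1 v =
      labelsOn T (branch T r v (insert c D)) v := by
  have := listAt_actualize (A := A) ignoresTmp_twoGraphsRule s
  rw [h.var_v] at this
  rw [this, labelsOn_branch_insert hT hD hc hcD]
  ext l
  rw [Set.mem_ofPred_eq, eval_twoGraphsRule, hu, h.var_v, hl, h.listAt_child c hc hi]

theorem ReadyAt.run_oneVertex (hT : T.IsTree) {v c : Fin n} {s : State}
    (h : ReadyAt T r v s) (hu : s.var .u = c) (hi : IsInternal T c) (hc : c ∈ childSet T r v) :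
    listAt ((actualize oneVertexRule).run A s).1 v =
      labelsOn T (branch T r v (insert c ∅)) v := by
  have := listAt_actualize (A := A) ignoresTmp_oneVertexRule s
  rw [h.var_v] at this
  rw [this, labelsOn_branch_insert hT (Set.empty_subset _) hc (Set.notMem_empty c), branch_empty,
    labelsOn_singleton]
  ext l
  rw [Set.mem_ofPred_eq, eval_oneVertexRule, hu, h.listAt_child c hc hi]

/-- The set `D₀` stands for the leaves already accounted for; the loop adds the internal children in
the order of the list. The program tests for internality as well, because the cells of `lab` at
leaves are arbitrary. -/
theorem run_addToStar (hT : T.IsTree) (hA : A.Represents T) {v : Fin n} {s : State}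
    {D₀ : Set (Fin n)} (h : ReadyAt T r v s) (hD₀ : D₀ ⊆ childSet T r v)
    (hleaf : ∀ c ∈ D₀, ¬ IsInternal T c)
    (hl : listAt s v = labelsOn T (branch T r v D₀) v) :
    listAt (addToStar.run A s).1 v =
        labelsOn T (branch T r v (D₀ ∪ {c | c ∈ childSet T r v ∧ IsInternal T c})) v ∧
      ∀ w ≠ (v : ℕ), listAt (addToStar.run A s).1 w = listAt s w := by
  have key := Cmd.run_loop_state (A := A) (x := .j) (e := .deg (.var .v)) (s := s)
    (c := .block [.set .u (.nbr (.var .v) (.var .j)),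
      .when (.and (internalTest (.var .u)) childTest) [actualize twoGraphsRule]])
    (I := fun m t => t.var .v = s.var .v ∧ t.arr .lab = s.arr .lab ∧
      (∀ w ≠ (v : ℕ), listAt t w = listAt s w) ∧
      listAt t v = labelsOn T (branch T r v
        (D₀ ∪ seen n A v m ∩ {c | c ∈ childSet T r v ∧ IsInternal T c})) v)
    ⟨rfl, rfl, fun _ _ => rfl, by simpa [seen_zero] using hl⟩ ?_
  · have hd : (Expr.deg (.var .v)).eval A s = (A.adj v).length := by
      simp [Expr.eval, h.var_v]
    rw [hd, hA.seen_length] at key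
    have hsub : {c | c ∈ childSet T r v ∧ IsInternal T c} ⊆ T.neighborSet v := fun c hc => hc.1.1
    rw [Set.inter_eq_right.2 hsub] at key
    exact ⟨key.2.2.2, key.2.2.1⟩
  · rintro m hm t ⟨htv, htlab, htR, htl⟩
    simp only [Expr.eval, h.var_v] at hm
    obtain ⟨c, hc, hvc, hnot, hseen⟩ := hA.exists_nbr v hm
    have hv' : t.var .v = v := htv.trans h.var_v
    simp only [Cmd.run_block_cons, Cmd.run_block_nil, Cmd.run_set, Cmd.run_when, Expr.eval,
      State.setVar_var, if_true, if_false, reduceCtorEq, hv', hc, hseen]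
    have hr1 : ReadyAt T r v ((t.setVar .j m).setVar .u c) :=
      h.of_eq (by simp [State.setVar_var, htv]) htlab htR
    have hu : ((t.setVar .j m).setVar .u c).var .u = c := by simp
    have hev := hA.eval_internalTest (e := .var .u) (s := (t.setVar .j m).setVar .u c)
      (v := c) hu
    have hcond : (Cond.and (internalTest (.var .u)) childTest).eval A
        ((t.setVar .j m).setVar .u c) = true ↔
        c ∈ ({c | c ∈ childSet T r v ∧ IsInternal T c} : Set (Fin n)) := by
      rw [Cond.eval_and, hev, Set.mem_ofPred_eq, and_comm]
      exact and_congr_left fun hi => hr1.eval_childTest hu hvc hi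
    by_cases hi : c ∈ ({c | c ∈ childSet T r v ∧ IsInternal T c} : Set (Fin n))
    · rw [if_pos (hcond.2 hi)]
      refine ⟨?_, ?_, ?_, ?_⟩
      · rw [Cmd.run_var (by decide), ← htv]
        simp [State.setVar_var]
      · rw [Cmd.run_arr (by decide), ← htlab]
        rfl
      · intro w hw
        rw [listAt_actualize_ne ignoresTmp_twoGraphsRule _ (by rw [hr1.var_v]; exact hw),
          ← htR w hw]
        rfl
      · rw [Set.insert_inter_of_mem hi, Set.union_insert]
        refine hr1.run_twoGraphs hT hu hi.2 hi.1 (Set.union_subset hD₀ fun x hx => hx.2.1) ?_ htl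
        rintro (h' | h')
        · exact hleaf c h' hi.2
        · exact hnot h'.1
    · rw [if_neg fun h => hi (hcond.1 h), Set.insert_inter_of_notMem hi]
      exact ⟨by rw [← htv]; simp [State.setVar_var], htlab, htR, htl⟩

theorem run_addToCentre (hT : T.IsTree) (hA : A.Represents T) {v : Fin n} {s : State}
    (h : ReadyAt T r v s) (hint : ∀ c, T.Adj v c → IsInternal T c) (hp : s.var .picked = 0)
    (hv : IsInternal T v) :
    listAt (addToCentre.run A s).1 v = labelsOn T (branch T r v (childSet T r v)) v ∧
      ∀ w ≠ (v : ℕ), listAt (addToCentre.run A s).1 w = listAt s w := by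
  have key := Cmd.run_loop_state (A := A) (x := .j) (e := .deg (.var .v)) (s := s)
    (c := .block [.set .u (.nbr (.var .v) (.var .j)),
      .when childTest [
        .ite (.eq (.var .picked) (.const 0))
          (.block [actualize oneVertexRule, .set .picked (.const 1)])
          (actualize twoGraphsRule)]])
    (I := fun m t => t.var .v = s.var .v ∧ t.arr .lab = s.arr .lab ∧
      (∀ w ≠ (v : ℕ), listAt t w = listAt s w) ∧
      -- Nothing is claimed about the list of `v` until a child has been met; the one-vertex rule
      -- then overwrites it without reading it.
      ((t.var .picked = 0 ∧ seen n A v m ∩ childSet T r v = ∅) ∨ (t.var .picked = 1 ∧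
        listAt t v = labelsOn T (branch T r v (seen n A v m ∩ childSet T r v)) v)))
    ⟨rfl, rfl, fun _ _ => rfl, Or.inl ⟨hp, by simp [seen_zero]⟩⟩ ?_
  · have hd : (Expr.deg (.var .v)).eval A s = (A.adj v).length := by
      simp [Expr.eval, h.var_v]
    rw [hd, hA.seen_length] at key
    have hsub : childSet T r v ⊆ T.neighborSet v := fun c hc => hc.1
    rw [Set.inter_eq_right.2 hsub] at key
    refine ⟨?_, key.2.2.1⟩
    rcases key.2.2.2 with ⟨-, h'⟩ | h'
    · exact absurd h' (childSet_nonempty hT hv).ne_empty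
    · exact h'.2
  · rintro m hm t ⟨htv, htlab, htR, htl⟩
    simp only [Expr.eval, h.var_v] at hm
    obtain ⟨c, hc, hvc, hnot, hseen⟩ := hA.exists_nbr v hm
    have hv' : t.var .v = v := htv.trans h.var_v
    simp only [Cmd.run_block_cons, Cmd.run_block_nil, Cmd.run_set, Cmd.run_when, Expr.eval,
      State.setVar_var, if_true, if_false, reduceCtorEq, hv', hc, hseen, Cmd.run_ite,
      Cond.eval_eq]
    have hr1 : ReadyAt T r v ((t.setVar .j m).setVar .u c) :=
      h.of_eq (by simp [State.setVar_var, htv]) htlab htR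
    have hu : ((t.setVar .j m).setVar .u c).var .u = c := by simp
    have hi := hint c hvc
    have hcond := hr1.eval_childTest (A := A) hu hvc hi
    by_cases hcc : c ∈ childSet T r v
    · rw [if_pos (hcond.2 hcc), Set.insert_inter_of_mem hcc]
      rcases htl with ⟨hp0, hemp⟩ | ⟨hp1, hl⟩
      · rw [if_pos hp0, hemp]
        refine ⟨?_, ?_, ?_, Or.inr ⟨by simp, ?_⟩⟩
        · rw [State.setVar_var, if_neg (by decide), Cmd.run_var (by decide), ← htv]
          simp [State.setVar_var]
        · rw [State.setVar_arr, Cmd.run_arr (by decide), ← htlab]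
          rfl
        · intro w hw
          rw [listAt_setVar,
            listAt_actualize_ne ignoresTmp_oneVertexRule _ (by rw [hr1.var_v]; exact hw),
            ← htR w hw]
          rfl
        · exact hr1.run_oneVertex hT hu hi hcc
      · rw [if_neg (by omega)]
        refine ⟨?_, ?_, ?_, Or.inr ⟨?_, ?_⟩⟩
        · rw [Cmd.run_var (by decide), ← htv]
          simp [State.setVar_var]
        · rw [Cmd.run_arr (by decide), ← htlab]
          rfl
        · intro w hw
          rw [listAt_actualize_ne ignoresTmp_twoGraphsRule _ (by rw [hr1.var_v]; exact hw),
            ← htR w hw]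
          rfl
        · rw [Cmd.run_var (by decide), ← hp1]
          simp [State.setVar_var]
        · exact hr1.run_twoGraphs hT hu hi hcc Set.inter_subset_right (fun h' => hnot h'.1) hl
    · rw [if_neg fun h => hcc (hcond.1 h), Set.insert_inter_of_notMem hcc]
      exact ⟨by rw [← htv]; simp [State.setVar_var], htlab, htR, by
        simpa [State.setVar_var, listAt_setVar] using htl⟩

theorem run_processVertex (hT : T.IsTree) (hA : A.Represents T) (hr : IsInternal T r)
    {v : Fin n} {s : State} (h : ReadyAt T r v s) (hv : IsInternal T v) :
    listAt (processVertex.run A s).1 v = labelsOn T (subtree T r v) v ∧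
      ∀ w ≠ (v : ℕ), listAt (processVertex.run A s).1 w = listAt s w := by
  rw [processVertex_eq]
  simp only [Cmd.run_block_cons, Cmd.run_block_nil, Cmd.run_set, Cmd.run_ite, Expr.eval,
    Cond.eval_lt]
  set t := (countLeaves.run A (s.setVar .leaves 0)).1 with ht
  have htl : t.var .leaves = ({c | T.Adj v c ∧ ¬ IsInternal T c} : Set (Fin n)).ncard :=
    run_countLeaves hA (by simp [State.setVar_var, h.var_v]) (by simp)
  have htR : ∀ w, listAt t w = listAt s w := listAt_congr fun l => by
    rw [ht, Cmd.run_arr (by cases l <;> decide)]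
    rfl
  have htr : ReadyAt T r v t := h.of_eq
    (by rw [ht, Cmd.run_var (by decide)]; simp [State.setVar_var])
    (by rw [ht, Cmd.run_arr (by decide)]; rfl) fun w _ => htR w
  have hsub : ({c | T.Adj v c ∧ ¬ IsInternal T c} : Set (Fin n)) ⊆ childSet T r v :=
    fun c hc => leaf_mem_childSet hT hr hc.1 hc.2
  rw [← branch_childSet hT]
  split_ifs with hpos
  · have hne : ∀ w ≠ (v : ℕ), listAt ((actualize starRule).run A t).1 w = listAt t w :=
      fun w hw => listAt_actualize_ne ignoresTmp_starRule _ (by rwa [htr.var_v])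
    have hr2 : ReadyAt T r v ((actualize starRule).run A t).1 := htr.of_eq
      (Cmd.run_var (by decide) _) (Cmd.run_arr (by decide) _) hne
    have hstar := listAt_actualize (A := A) ignoresTmp_starRule t
    rw [htr.var_v] at hstar
    obtain ⟨h1, h2⟩ := run_addToStar hT hA hr2 hsub (fun c hc => hc.2) (by
      rw [hstar, labelsOn_branch_leaves hT hsub fun c hc => hc.2]
      ext l
      rw [Set.mem_ofPred_eq, eval_starRule l t hpos, htl])
    refine ⟨?_, fun w hw => by rw [h2 w hw, hne w hw, htR w]⟩
    rw [h1]
    congr 2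
    -- The leaves next to `v` are all children, so together with the internal children they exhaust
    -- `childSet T r v`.
    ext c
    constructor
    · rintro (h' | h')
      · exact hsub h'
      · exact h'.1
    · intro hc
      by_cases hi : IsInternal T c
      · exact Or.inr ⟨hc, hi⟩
      · exact Or.inl ⟨hc.1, hi⟩
  · have hint : ∀ c, T.Adj v c → IsInternal T c := by
      intro c hc
      by_contra hi
      have h0 : ({c | T.Adj v c ∧ ¬ IsInternal T c} : Set (Fin n)).ncard = 0 := by omega
      rw [Set.ncard_eq_zero] at h0
      exact Set.notMem_empty c (h0 ▸ ⟨hc, hi⟩)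
    obtain ⟨h1, h2⟩ := run_addToCentre hT hA (A := A) (s := t.setVar .picked 0)
      (htr.of_eq (by simp [State.setVar_var]) rfl fun _ _ => rfl) hint (by simp) hv
    exact ⟨h1, fun w hw => by rw [h2 w hw, listAt_setVar, htR w]⟩

end ProcessVertex

/-! ### The second phase: correctness and linear time -/

section LabelPhase

variable {n : ℕ} {T : SimpleGraph (Fin n)} {A : Input} {r : Fin n}

/-- `lab` is injective on the internal vertices, having the inverse `vert`, and takes values below
their number. By counting it is onto. -/
theorem IsBottomUpNumbering.exists_vertex {s : State} (h : IsBottomUpNumbering T r s) {i : ℕ}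
    (hi : i < s.var .count) :
    ∃ v : Fin n, IsInternal T v ∧ s.arr .lab v = i ∧ s.arr .vert i = v := by
  have hinj : Set.InjOn (fun v : Fin n => s.arr .lab v) {v | IsInternal T v} := by
    intro v hv w hw hvw
    have h1 := h.vert_lab v hv
    have h2 := h.vert_lab w hw
    simp only at hvw
    rw [hvw, h2] at h1
    exact Fin.ext h1.symm
  have himg : (fun v : Fin n => s.arr .lab v) '' {v | IsInternal T v} = Set.Iio (s.var .count) := by
    refine Set.eq_of_subset_of_ncard_le ?_ ?_ (Set.finite_Iio _)
    · rintro _ ⟨v, hv, rfl⟩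
      exact h.lab_lt v hv
    · rw [hinj.ncard_image, ← h.count_eq]
      simp
  obtain ⟨v, hv, hvi⟩ : i ∈ (fun v : Fin n => s.arr .lab v) '' {v | IsInternal T v} := by
    rw [himg]; exact hi
  simp only at hvi
  exact ⟨v, hv, hvi, by rw [← hvi]; exact h.vert_lab v hv⟩

/-- Of two adjacent vertices one lies below the other, so comparing numbers tells which. This
justifies `childTest`. -/
theorem IsBottomUpNumbering.lab_lt_iff (hT : T.IsTree) {s : State}
    (h : IsBottomUpNumbering T r s) {v c : Fin n} (hv : IsInternal T v) (hc : IsInternal T c)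
    (hvc : T.Adj v c) : s.arr .lab c < s.arr .lab v ↔ c ∈ childSet T r v := by
  refine ⟨fun hlt => ⟨hvc, (mem_subtree_or_of_adj hT hvc).resolve_right fun hh => ?_⟩,
    fun hh => h.desc_lt c v hc hv hvc.ne' hh.2⟩
  exact absurd (h.desc_lt v c hv hc hvc.ne hh) (by omega)

/-- The commands of `labelPhase` for one vertex after the vertex was loaded. -/
def labelStep : List Cmd := [
  processVertex,
  .when (.not (.any (Label.all.map (fun l => hasLabel l (.var .v))))) [
    .set .answer (.const 0), .set .stopped (.const 1)]]

/-- The loop of `labelPhase` that clears the lists. -/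
def clearLists : Cmd :=
  .loop .i .size (.block (Label.all.map (fun l => .store (.R l) (.var .i) (.const 0))))

/-- The loop of `labelPhase` over the internal vertices. -/
def labelLoop : Cmd := .loop .i (.var .count) (.when (.eq (.var .stopped) (.const 0))
    (.set .v (.arr .vert (.var .i)) :: labelStep))

/-- The last command of `labelPhase`. -/
def decideAnswer : Cmd := .when (.eq (.var .stopped) (.const 0)) [
    .ite (.any ([.zero, .one, .two].map (fun l => hasLabel l (.var .root))))
      (.set .answer (.const 1)) (.set .answer (.const 0))]

theorem labelPhase_eq : labelPhase =
    .block [clearLists, .set .stopped (.const 0), labelLoop, decideAnswer] := rfl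

/-- The memory `t` after the first `i` iterations of the loop over the internal vertices;
`s` is the memory before the loop. -/
structure LabelInvariant (T : SimpleGraph (Fin n)) (r : Fin n) (s : State) (i : ℕ) (t : State) :
    Prop where
  lab_eq : t.arr .lab = s.arr .lab
  vert_eq : t.arr .vert = s.arr .vert
  lists : ∃ m ≤ i, (∀ v, IsInternal T v → s.arr .lab v < m →
      listAt t v = labelsOn T (subtree T r v) v) ∧
    ((t.var .stopped = 0 ∧ m = i ∧
      ∀ v, IsInternal T v → s.arr .lab v < i → (labelsOn T (subtree T r v) v).Nonempty) ∨
    (t.var .stopped = 1 ∧ t.var .answer = 0 ∧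
      ∃ v, IsInternal T v ∧ s.arr .lab v < m ∧ labelsOn T (subtree T r v) v = ∅))

/-- The number `m` in the invariant counts the vertices really processed. It equals `i` until an
empty list appears and stays fixed from then on. Children have smaller numbers, so their lists are
final when a vertex is reached. -/
theorem run_labelLoop (hT : T.IsTree) (hA : A.Represents T) {s : State}
    (h : IsBottomUpNumbering T r s) (hs : s.var .stopped = 0) :
    LabelInvariant T r s (s.var .count) (labelLoop.run A s).1 := by
  refine Cmd.run_loop_state (A := A) (x := .i) (e := .var .count) (s := s)
    (I := LabelInvariant T r s)
    ⟨rfl, rfl, 0, le_rfl, fun v _ hv => absurd hv (by omega),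
      Or.inl ⟨hs, rfl, fun v _ hv => absurd hv (by omega)⟩⟩ ?_
  intro i hi t ht
  obtain ⟨hlab, hvert, m, hm, hlists, hcase⟩ := ht
  simp only [Expr.eval] at hi
  obtain ⟨v, hv, hvi, hiv⟩ := h.exists_vertex hi
  rw [Cmd.run_when]
  rcases hcase with ⟨hst, rfl, hne⟩ | ⟨hst, hans, hemp⟩
  · have hcond : (Cond.eq (.var .stopped) (.const 0)).eval A (t.setVar .i m) = true := by
      rw [Cond.eval_eq]
      simpa [Expr.eval, State.setVar_var] using hst
    rw [if_pos hcond, Cmd.run_block_cons, Cmd.run_set, labelStep, Cmd.run_block_cons,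
      Cmd.run_block_cons, Cmd.run_block_nil]
    have hev : (Expr.arr .vert (.var .i)).eval A (t.setVar .i m) = v := by
      simp [Expr.eval, hvert, hiv]
    rw [hev]
    set t' := (t.setVar .i m).setVar .v v with ht'
    have hready : ReadyAt T r v t' := by
      refine ⟨by simp [ht'], ?_, ?_⟩
      · intro c hc hci
        rw [show t'.arr .lab = s.arr .lab from hlab]
        exact h.lab_lt_iff hT hv hci hc
      · intro c hc hci
        refine hlists c hci ?_
        rw [← hvi]
        exact (h.lab_lt_iff hT hv hci hc.1).2 hc
    obtain ⟨h1, h2⟩ := run_processVertex hT hA h.root_internal hready hv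
    set t'' := (processVertex.run A t').1 with ht''
    have hv'' : t''.var .v = v := (Cmd.run_var (by decide) _).trans (by simp [ht'])
    have hlab'' : t''.arr .lab = s.arr .lab := (Cmd.run_arr (by decide) _).trans hlab
    have hvert'' : t''.arr .vert = s.arr .vert := (Cmd.run_arr (by decide) _).trans hvert
    have hlists'' : ∀ w, IsInternal T w → s.arr .lab w < m + 1 →
        listAt t'' w = labelsOn T (subtree T r w) w := by
      intro w hw hwm
      by_cases hwv : w = v
      · rw [hwv, h1]
      · rw [h2 w fun e => hwv (Fin.ext e)]
        refine hlists w hw (lt_of_le_of_ne (by omega) fun e => hwv (Fin.ext ?_))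
        rw [← h.vert_lab w hw, ← h.vert_lab v hv, e, hvi]
    have hany : (Cond.not (.any (Label.all.map fun l => hasLabel l (.var .v)))).eval A t'' = true ↔
        labelsOn T (subtree T r v) v = ∅ := by
      rw [Cond.eval_not, eval_any_hasLabel, ← h1, Set.not_nonempty_iff_eq_empty]
      simp only [Expr.eval, hv'']
    rw [Cmd.run_when]
    by_cases hemp : labelsOn T (subtree T r v) v = ∅
    · rw [if_pos (hany.2 hemp)]
      refine ⟨hlab'', hvert'', m + 1, le_rfl, hlists'', Or.inr ⟨?_, ?_, v, hv, by omega, hemp⟩⟩ <;>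
        simp [Cmd.run_block_cons, Cmd.run_block_nil, Cmd.run_set, Expr.eval, State.setVar_var]
    · rw [if_neg fun hh => hemp (hany.1 hh)]
      refine ⟨hlab'', hvert'', m + 1, le_rfl, hlists'', Or.inl ⟨?_, rfl, ?_⟩⟩
      · rw [ht'', Cmd.run_var (by decide), ht']
        simpa [State.setVar_var] using hst
      · intro w hw hwm
        by_cases hwv : w = v
        · rw [hwv]
          exact Set.nonempty_iff_ne_empty.2 hemp
        · refine hne w hw (lt_of_le_of_ne (by omega) fun e => hwv (Fin.ext ?_))
          rw [← h.vert_lab w hw, ← h.vert_lab v hv, e, hvi]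
  · have hcond : ¬ (Cond.eq (.var .stopped) (.const 0)).eval A (t.setVar .i i) = true := by
      rw [Cond.eval_eq]
      simp [Expr.eval, State.setVar_var, hst]
    rw [if_neg hcond]
    exact ⟨hlab, hvert, m, by omega, hlists,
      Or.inr ⟨by simpa [State.setVar_var] using hst, by simpa [State.setVar_var] using hans, hemp⟩⟩

theorem IsBottomUpNumbering.of_eq {s t : State} (h : IsBottomUpNumbering T r s)
    (h1 : t.var .root = s.var .root) (h2 : t.var .count = s.var .count)
    (h3 : t.arr .lab = s.arr .lab) (h4 : t.arr .vert = s.arr .vert) :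
    IsBottomUpNumbering T r t where
  root_internal := h.root_internal
  root_eq := h1.trans h.root_eq
  count_eq := h2.trans h.count_eq
  lab_lt := by rw [h2, h3]; exact h.lab_lt
  vert_lab := by rw [h3, h4]; exact h.vert_lab
  desc_lt := by rw [h3]; exact h.desc_lt

theorem run_labelPhase (hT : T.IsTree) (hA : A.Represents T) {s : State}
    (h : IsBottomUpNumbering T r s) :
    AnswerCorrect T (labelPhase.run A s).1 ∧
    ∀ v : Fin n, IsInternal T v →
      (∀ u : Fin n, IsInternal T u → s.arr .lab u < s.arr .lab v →
        (possibleLabels T r u).Nonempty) →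
      labelList (labelPhase.run A s).1 v = possibleLabels T r v := by
  rw [labelPhase_eq]
  simp only [Cmd.run_block_cons, Cmd.run_block_nil, Cmd.run_set, Expr.eval]
  set s' := (clearLists.run A s).1.setVar .stopped 0 with hs'
  have hlab' : s'.arr .lab = s.arr .lab := Cmd.run_arr (by decide) _
  have h' : IsBottomUpNumbering T r s' := by
    refine h.of_eq ?_ ?_ hlab' (Cmd.run_arr (by decide) _) <;>
    · rw [hs', State.setVar_var, if_neg (by decide), Cmd.run_var (by decide)]
  obtain ⟨-, -, m, hm, hlists, hcase⟩ := run_labelLoop hT hA h' (by simp [hs'])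
  have hroot : (labelLoop.run A s').1.var .root = r :=
    (Cmd.run_var (by decide) _).trans h'.root_eq
  set t := (labelLoop.run A s').1
  have hfin : ∀ w, listAt (decideAnswer.run A t).1 w = listAt t w :=
    listAt_congr fun l => Cmd.run_arr (by cases l <;> decide) _
  simp only [labelList_eq, possibleLabels_eq, Set.image_nonempty, hfin]
  rcases hcase with ⟨hst, rfl, hne⟩ | ⟨hst, hans, v, hv, hvm, hemp⟩
  · refine ⟨?_, fun v hv _ => by rw [hlists v hv (h'.lab_lt v hv)]⟩
    have hcond : (Cond.any ([Label.zero, .one, .two].map fun l => hasLabel l (.var .root))).eval A t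
        = true ↔ ∃ S, IsIndepOneTwoSet T S := by
      rw [Cond.eval_any, exists_isIndepOneTwoSet_iff (r := r),
        ← hlists r h.root_internal (h'.lab_lt r h.root_internal), ← hroot]
      simp only [List.map_cons, List.map_nil, List.mem_cons, List.not_mem_nil, or_false,
        exists_eq_or_imp, exists_eq_left, eval_hasLabel, Expr.eval]
    rw [decideAnswer, Cmd.run_when, if_pos ((Cond.eval_eq (.var .stopped) (.const 0) t).2 hst),
      Cmd.run_block_cons, Cmd.run_block_nil, Cmd.run_ite]
    by_cases hS : ∃ S, IsIndepOneTwoSet T S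
    · rw [if_pos (hcond.2 hS)]
      exact Or.inl ⟨by simp [Cmd.run_set, Expr.eval], hS⟩
    · rw [if_neg fun hh => hS (hcond.1 hh)]
      exact Or.inr ⟨by simp [Cmd.run_set, Expr.eval], hS⟩
  · constructor
    · refine Or.inr ⟨?_, ?_⟩
      · rw [decideAnswer, Cmd.run_when, if_neg, hans]
        rw [Cond.eval_eq]
        simp [Expr.eval, hst]
      · rintro ⟨S, hS⟩
        exact (labelsOn_subtree_nonempty (r := r) v hS).ne_empty hemp
    · intro w hw hearlier
      -- A vertex that was not processed comes after the one with the empty list, against the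
      -- assumption on earlier vertices.
      rw [hlists w hw]
      by_contra hlt
      have := hearlier v hv (by rw [← hlab']; omega)
      exact this.ne_empty hemp

theorem Cmd.cost_when_le {b : Cond} {x : Var} {e : Expr} {cs : List Cmd}
    (h : (Cmd.block cs).scans x = true) (s : State) :
    ((Cmd.when b (.set x e :: cs)).run A s).2 ≤ (Cmd.when b (.set x e :: cs)).base +
      (Cmd.block cs).slope * (A.adj (e.eval A s)).length := by
  have := Cmd.cost_le_of_scans (A := A) h (s.setVar x (e.eval A s))
  rw [State.setVar_var_self] at this
  simp only [Cmd.when, Cmd.block, Cmd.run, Cmd.base]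
  split_ifs <;> omega

theorem Cmd.cost_block_cons (c : Cmd) (cs : List Cmd) (s : State) :
    ((Cmd.block (c :: cs)).run A s).2 =
      (c.run A s).2 + ((Cmd.block cs).run A (c.run A s).1).2 + 1 := rfl

theorem Cmd.cost_block_nil (s : State) : ((Cmd.block []).run A s).2 = 1 := rfl

theorem Cmd.cost_loop_flat {x : Var} {e : Expr} {c : Cmd} (h : c.flat = true) (s : State) :
    ((Cmd.loop x e c).run A s).2 ≤ e.cost + 1 + e.eval A s * (c.base + 1) := by
  have := (Cmd.run_loop (A := A) (x := x) (e := e) (c := c) (s := s)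
    (fun _ _ => True) (fun _ => c.base) trivial
    fun m _ t _ => ⟨trivial, Cmd.cost_le_of_flat h _⟩).2
  simpa [Finset.sum_const, Finset.card_range, smul_eq_mul] using this

/-- The vertices `q i` are distinct, so there are at most `n` of them and their degrees sum to at
most `2 * n`. -/
theorem sum_cost_le (hA : A.Represents T) (hT : T.IsTree) {k : ℕ} {q : ℕ → ℕ} (a b : ℕ)
    (hq : ∀ i < k, q i < n) (hinj : ∀ i < k, ∀ j < k, q i = q j → i = j) :
    ∑ i ∈ Finset.range k, (a + b * (A.adj (q i)).length + 1) ≤ (a + 1 + 2 * b) * n := by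
  have hk : k ≤ n := by
    have hsub : (Finset.range k).image q ⊆ Finset.range n := by
      intro x hx
      obtain ⟨i, hi, rfl⟩ := Finset.mem_image.1 hx
      exact Finset.mem_range.2 (hq i (Finset.mem_range.1 hi))
    have := Finset.card_le_card hsub
    rwa [Finset.card_image_of_injOn fun i hi j hj h => hinj i (by simpa using hi) j
      (by simpa using hj) h, Finset.card_range, Finset.card_range] at this
  have h1 := hA.sum_length_le hT hq hinj
  have h2 : ∑ i ∈ Finset.range k, (a + b * (A.adj (q i)).length + 1) =
      k * (a + 1) + b * ∑ i ∈ Finset.range k, (A.adj (q i)).length := by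
    simp only [Finset.sum_add_distrib, Finset.sum_const, Finset.card_range, smul_eq_mul,
      ← Finset.mul_sum]
    ring
  rw [h2]
  calc k * (a + 1) + b * ∑ i ∈ Finset.range k, (A.adj (q i)).length
      ≤ n * (a + 1) + b * (2 * n) := by gcongr
    _ = (a + 1 + 2 * b) * n := by ring

theorem exists_cost_labelPhase_le : ∃ C : ℕ, ∀ (n : ℕ) (T : SimpleGraph (Fin n)) (_ : T.IsTree)
    (A : Input) (_ : A.Represents T) (r : Fin n) (s : State), IsBottomUpNumbering T r s →
      (labelPhase.run A s).2 ≤ C * n := by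
  -- The constants are found by unification with the syntactic bounds of the fixed programs.
  -- Obtaining them from existential statements keeps their values opaque, and they do not depend on
  -- the input.
  obtain ⟨a₁, ha₁⟩ : ∃ a : ℕ, ∀ (A : Input) s, (clearLists.run A s).2 ≤ 2 + A.n * a :=
    ⟨_, fun A s => Cmd.cost_loop_flat (by decide) s⟩
  obtain ⟨a₂, ha₂⟩ : ∃ a : ℕ, ∀ (A : Input) s, (decideAnswer.run A s).2 ≤ a :=
    ⟨_, fun A s => Cmd.cost_le_of_flat (by decide) s⟩
  obtain ⟨a, b, hab⟩ : ∃ a b : ℕ, ∀ (A : Input) (s : State),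
      ((Cmd.when (.eq (.var .stopped) (.const 0))
        (.set .v (.arr .vert (.var .i)) :: labelStep)).run A s).2 ≤
        a + b * (A.adj (s.arr .vert (s.var .i))).length :=
    ⟨_, _, fun A s => Cmd.cost_when_le (by decide) s⟩
  refine ⟨a₁ + a₂ + (a + 1 + 2 * b) + 20, fun n T hT A hA r s h => ?_⟩
  have hn : 1 ≤ n := Nat.one_le_of_lt r.2
  set s' := (clearLists.run A s).1.setVar .stopped 0 with hs'
  have hcount : s'.var .count = s.var .count := by
    rw [hs', State.setVar_var, if_neg (by decide), Cmd.run_var (by decide)]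
  have hvert : s'.arr .vert = s.arr .vert := Cmd.run_arr (by decide) _
  have hloop := (Cmd.run_loop (A := A) (x := .i) (e := .var .count) (s := s')
    (c := .when (.eq (.var .stopped) (.const 0)) (.set .v (.arr .vert (.var .i)) :: labelStep))
    (fun _ t => t.arr .vert = s.arr .vert)
    (fun i => a + b * (A.adj (s.arr .vert i)).length) hvert
    (fun i _ t ht => ⟨(Cmd.run_arr (by decide) _).trans ht, by
      refine (hab A _).trans ?_
      rw [State.setVar_arr, State.setVar_var_self, ht]⟩)).2
  simp only [Expr.eval, Expr.cost, hcount] at hloop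
  have hsum := sum_cost_le hA hT (k := s.var .count) (q := s.arr .vert) a b
    (fun i hi => by
      obtain ⟨v, -, -, hv⟩ := h.exists_vertex hi
      rw [hv]; exact v.2)
    (fun i hi j hj hij => by
      obtain ⟨v, -, hvi, hv⟩ := h.exists_vertex hi
      obtain ⟨w, -, hwj, hw⟩ := h.exists_vertex hj
      rw [hv, hw] at hij
      rw [← hvi, ← hwj, hij])
  have h1 := ha₁ A s
  rw [hA.1] at h1
  have h2 := ha₂ A (labelLoop.run A s').1
  rw [labelPhase_eq]
  simp only [Cmd.cost_block_cons, Cmd.cost_block_nil]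
  have h3 : ((Cmd.set .stopped (.const 0)).run A (clearLists.run A s).1).2 = 2 := rfl
  have h4 : ((Cmd.set .stopped (.const 0)).run A (clearLists.run A s).1).1 = s' := rfl
  have h5 : (labelLoop.run A s').2 ≤ 2 + (a + 1 + 2 * b) * n := hloop.trans (by omega)
  rw [h3, h4]
  have h6 : a₂ ≤ a₂ * n := Nat.le_mul_of_pos_right _ hn
  have h7 : n * a₁ = a₁ * n := mul_comm _ _
  have h8 : (a₁ + a₂ + (a + 1 + 2 * b) + 20) * n =
    a₁ * n + a₂ * n + (a + 1 + 2 * b) * n + 20 * n := by ring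
  omega

end LabelPhase

/-! ### The first phase: root, breadth-first search, numbering -/

section OrderPhase

variable {n : ℕ} {T : SimpleGraph (Fin n)} {A : Input} {r : Fin n}

/-- The loop of `orderPhase` that looks for an internal vertex. -/
def findRoot : Cmd := .loop .i .size (.when (internalTest (.var .i))
    [.set .root (.var .i), .set .found (.const 1)])

/-- The command of the breadth first search for the neighbour of `u` at position `j`. -/
def visitNeighbour : Cmd := .block [
  .set .w (.nbr (.var .u) (.var .j)),
  .when (.and (internalTest (.var .w)) (.not (.eq (.var .w) (.arr .par (.var .u))))) [
    .store .par (.var .w) (.var .u),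
    .store .queue (.var .count) (.var .w),
    .set .count (.succ (.var .count))]]

/-- The command of the breadth first search for the vertex at position `i` of the queue. -/
def visitVertex : Cmd := .when (.lt (.var .i) (.var .count)) [
  .set .u (.arr .queue (.var .i)),
  .loop .j (.deg (.var .u)) visitNeighbour]

/-- The breadth first search from the root. -/
def search : Cmd := .loop .i .size visitVertex

/-- The loop of `orderPhase` that numbers the vertices in the queue. -/
def numberVertices : Cmd := .loop .i (.var .count) (.block [
  .set .k (.pred (.var .k)),
  .set .u (.arr .queue (.var .i)),
  .store .vert (.var .k) (.var .u),
  .store .lab (.var .u) (.var .k)])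

/-- The commands of `orderPhase` that follow the choice of the root. -/
def orderFromRoot : List Cmd := [
  .store .queue (.const 0) (.var .root),
  .store .par (.var .root) (.var .root),
  .set .count (.const 1),
  search,
  .set .k (.var .count),
  numberVertices]

theorem run_findRoot (hA : A.Represents T) {s : State} (hs : s.var .found = 0) :
    ((findRoot.run A s).1.var .found = 1 ∧
      ∃ r : Fin n, IsInternal T r ∧ (findRoot.run A s).1.var .root = r) ∨
    ((findRoot.run A s).1.var .found = 0 ∧ ∀ v, ¬ IsInternal T v) := by
  have key := Cmd.run_loop_state (A := A) (x := .i) (e := .size) (s := s)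
    (c := .when (internalTest (.var .i)) [.set .root (.var .i), .set .found (.const 1)])
    (I := fun m t => (t.var .found = 1 ∧ ∃ r : Fin n, IsInternal T r ∧ t.var .root = r) ∨
      (t.var .found = 0 ∧ ∀ v : Fin n, (v : ℕ) < m → ¬ IsInternal T v))
    (Or.inr ⟨hs, fun v hv => absurd hv (by omega)⟩) ?_
  · refine key.imp_right fun h => ⟨h.1, fun v => h.2 v ?_⟩
    simp [Expr.eval, hA.1]
  · intro m hm t ht
    simp only [Expr.eval, hA.1] at hm
    have hev := hA.eval_internalTest (e := .var .i) (s := t.setVar .i m) (v := ⟨m, hm⟩)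
      (by simp [Expr.eval])
    rw [Cmd.run_when]
    by_cases hi : IsInternal T ⟨m, hm⟩
    · rw [if_pos (hev.2 hi)]
      refine Or.inl ⟨?_, ⟨m, hm⟩, hi, ?_⟩ <;>
        simp [Cmd.run_block_cons, Cmd.run_block_nil, Cmd.run_set, Expr.eval, State.setVar_var]
    · rw [if_neg fun h => hi (hev.1 h)]
      simp only [State.setVar_var, if_false, reduceCtorEq]
      refine ht.imp_right fun h => ⟨h.1, fun v hv => ?_⟩
      by_cases hvm : (v : ℕ) = m
      · rwa [show v = ⟨m, hm⟩ from Fin.ext hvm]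
      · exact h.2 v (by omega)

/-- The memory during the breadth first search, after the visit to the first `i` vertices of the
queue and to the neighbours in `D` of the next one. -/
structure SearchInvariant (T : SimpleGraph (Fin n)) (r : Fin n) (i : ℕ) (D : Set (Fin n))
    (t : State) : Prop where
  count_pos : 0 < t.var .count
  queue_zero : t.arr .queue 0 = r
  par_root : t.arr .par r = r
  queue_internal : ∀ j < t.var .count, ∃ v : Fin n, IsInternal T v ∧ t.arr .queue j = v
  queue_inj : ∀ j < t.var .count, ∀ j' < t.var .count,
    t.arr .queue j = t.arr .queue j' → j = j'
  exists_parent : ∀ j < t.var .count, j ≠ 0 → ∃ j' < j, ∃ p v : Fin n, t.arr .queue j' = p ∧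
    t.arr .queue j = v ∧ v ∈ childSet T r p ∧ t.arr .par v = p ∧ (j' < i ∨ (j' = i ∧ v ∈ D))
  exists_child : ∀ j < t.var .count, ∀ p c : Fin n, t.arr .queue j = p → c ∈ childSet T r p →
    IsInternal T c → (j < i ∨ (j = i ∧ c ∈ D)) → ∃ j' < t.var .count, t.arr .queue j' = c

theorem SearchInvariant.of_eq {i : ℕ} {D : Set (Fin n)} {s t : State}
    (h : SearchInvariant T r i D s) (h1 : t.var .count = s.var .count)
    (h2 : t.arr .queue = s.arr .queue) (h3 : t.arr .par = s.arr .par) :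
    SearchInvariant T r i D t := by
  obtain ⟨a, b, c, d, e, f, g⟩ := h
  constructor <;> rw [← h1, ← h2] at * <;> rw [← h3] at * <;> assumption

/-- For a queued vertex other than the root, `par` holds its parent, the only neighbour that is not
a child. The root is stored as its own parent, which no neighbour equals, and all its neighbours are
children. -/
theorem SearchInvariant.par_eq_iff (hT : T.IsTree) {i : ℕ} {D : Set (Fin n)} {t : State}
    (h : SearchInvariant T r i D t) {j : ℕ} (hj : j < t.var .count) {p c : Fin n}
    (hp : t.arr .queue j = p) (hpc : T.Adj p c) :
    t.arr .par p = c ↔ c ∉ childSet T r p := by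
  by_cases hj0 : j = 0
  · subst hj0
    obtain rfl : p = r := Fin.ext (hp.symm.trans h.queue_zero)
    rw [h.par_root]
    exact ⟨fun e => absurd (Fin.ext e) hpc.ne, fun hc => absurd ⟨hpc, mem_subtree_root c⟩ hc⟩
  · obtain ⟨j', -, q, v, -, hv, hvq, hpar, -⟩ := h.exists_parent j hj hj0
    obtain rfl : v = p := Fin.ext (hv.symm.trans hp)
    rw [hpar]
    constructor
    · intro e hc
      obtain rfl : q = c := Fin.ext e
      exact hpc.ne (subtree_antisymm hT.connected hc.2 hvq.2)
    · intro hc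
      have hvc : v ∈ subtree T r c :=
        (mem_subtree_or_of_adj hT hpc).resolve_left fun hh => hc ⟨hpc, hh⟩
      rw [parent_unique hT hvq.1 hvq.2 hpc.symm hvc]

/-- A queued vertex other than the root was entered from its unique parent. For `c` this is `p`, at
position `i`, so `c` would already be in `D`. No array of visited vertices is therefore needed. -/
theorem SearchInvariant.notMem_queue (hT : T.IsTree) {i : ℕ} {D : Set (Fin n)} {t : State}
    (h : SearchInvariant T r i D t) (hi : i < t.var .count) {p c : Fin n}
    (hp : t.arr .queue i = p) (hc : c ∈ childSet T r p) (hcD : c ∉ D) {j : ℕ}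
    (hj : j < t.var .count) : t.arr .queue j ≠ c := by
  intro hjc
  by_cases hj0 : j = 0
  · subst hj0
    obtain rfl : c = r := Fin.ext (hjc.symm.trans h.queue_zero)
    exact hc.1.ne (eq_root_of_root_mem_subtree hc.2)
  · obtain ⟨j', hj', q, v, hq, hv, hvq, -, hor⟩ := h.exists_parent j hj hj0
    obtain rfl : v = c := Fin.ext (hv.symm.trans hjc)
    obtain rfl : q = p := parent_unique hT hvq.1 hvq.2 hc.1 hc.2
    have : j' = i := h.queue_inj j' (by omega) i hi (hq.trans hp.symm)
    rcases hor with hlt | ⟨-, hvD⟩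
    · omega
    · exact hcD hvD

theorem SearchInvariant.insert_skip {i : ℕ} {D : Set (Fin n)} {t : State}
    (h : SearchInvariant T r i D t) {p c : Fin n} (hp : t.arr .queue i = p)
    (hc : ¬ (c ∈ childSet T r p ∧ IsInternal T c)) : SearchInvariant T r i (insert c D) t where
  count_pos := h.count_pos
  queue_zero := h.queue_zero
  par_root := h.par_root
  queue_internal := h.queue_internal
  queue_inj := h.queue_inj
  exists_parent j hj hj0 := by
    obtain ⟨j', hj', q, v, h1, h2, h3, h4, h5⟩ := h.exists_parent j hj hj0
    exact ⟨j', hj', q, v, h1, h2, h3, h4, h5.imp_right fun h5 => ⟨h5.1, Or.inr h5.2⟩⟩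
  exists_child j hj q d hq hd hdi hor := by
    refine h.exists_child j hj q d hq hd hdi (hor.imp_right fun ⟨hji, hor⟩ => ⟨hji, ?_⟩)
    refine hor.resolve_left ?_
    rintro rfl
    rw [hji] at hq
    obtain rfl : q = p := Fin.ext (hq.symm.trans hp)
    exact hc ⟨hd, hdi⟩

theorem SearchInvariant.insert_child (hT : T.IsTree) {i : ℕ} {D : Set (Fin n)} {t : State}
    (h : SearchInvariant T r i D t) (hi : i < t.var .count) {p c : Fin n}
    (hp : t.arr .queue i = p) (hc : c ∈ childSet T r p) (hci : IsInternal T c) (hcD : c ∉ D) :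
    SearchInvariant T r i (insert c D)
      (((t.setArr .par c p).setArr .queue (t.var .count) c).setVar .count (t.var .count + 1)) := by
  have hnot := fun {j} hj => h.notMem_queue hT hi hp hc hcD (j := j) hj
  set t' := ((t.setArr .par c p).setArr .queue (t.var .count) c).setVar .count (t.var .count + 1)
    with ht'
  have hcount : t'.var .count = t.var .count + 1 := by simp [ht']
  have hnew : t'.arr .queue (t.var .count) = c := by simp [ht', State.setArr_arr]
  have hold : ∀ j < t.var .count, t'.arr .queue j = t.arr .queue j := fun j hj => by
    simp [ht', State.setArr_arr, hj.ne]
  have hpc : t'.arr .par c = p := by simp [ht', State.setArr_arr]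
  have hpar : ∀ w, w ≠ (c : ℕ) → t'.arr .par w = t.arr .par w := fun w hw => by
    simp [ht', State.setArr_arr, hw]
  have hpos := h.count_pos
  constructor
  · omega
  · rw [hold 0 hpos, h.queue_zero]
  · rw [hpar, h.par_root]
    intro e
    exact hnot hpos (h.queue_zero.trans e)
  · intro j hj
    by_cases hjk : j = t.var .count
    · exact ⟨c, hci, by rw [hjk, hnew]⟩
    · rw [hold j (by omega)]
      exact h.queue_internal j (by omega)
  · intro j hj j' hj' e
    by_cases hjk : j = t.var .count <;> by_cases hjk' : j' = t.var .count
    · omega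
    · rw [hjk, hnew, hold j' (by omega)] at e
      exact absurd e.symm (hnot (by omega))
    · rw [hjk', hnew, hold j (by omega)] at e
      exact absurd e (hnot (by omega))
    · rw [hold j (by omega), hold j' (by omega)] at e
      exact h.queue_inj j (by omega) j' (by omega) e
  · intro j hj hj0
    by_cases hjk : j = t.var .count
    · exact ⟨i, by omega, p, c, by rw [hold i hi, hp], by rw [hjk, hnew], hc, hpc,
        Or.inr ⟨rfl, Or.inl rfl⟩⟩
    · obtain ⟨j', hj', q, v, h1, h2, h3, h4, h5⟩ := h.exists_parent j (by omega) hj0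
      refine ⟨j', hj', q, v, by rw [hold j' (by omega), h1], by rw [hold j (by omega), h2], h3, ?_,
        h5.imp_right fun h5 => ⟨h5.1, Or.inr h5.2⟩⟩
      rw [hpar, h4]
      intro e
      exact hnot (j := j) (by omega) (h2.trans e)
  · intro j hj q d hq hd hdi hor
    by_cases hjk : j = t.var .count
    · omega
    · rw [hold j (by omega)] at hq
      by_cases hdc : d = c
      · exact ⟨t.var .count, by omega, by rw [hnew, hdc]⟩
      · obtain ⟨j', hj', h'⟩ := h.exists_child j (by omega) q d hq hd hdi
          (hor.imp_right fun h => ⟨h.1, h.2.resolve_left hdc⟩)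
        exact ⟨j', by omega, by rw [hold j' hj', h']⟩

theorem run_visitNeighbours (hT : T.IsTree) (hA : A.Represents T) {i : ℕ} {s : State}
    (h : SearchInvariant T r i ∅ s) (hi : i < s.var .count) {p : Fin n}
    (hp : s.arr .queue i = p) (hu : s.var .u = p) :
    SearchInvariant T r i (T.neighborSet p)
        ((Cmd.loop .j (.deg (.var .u)) visitNeighbour).run A s).1 ∧
      s.var .count ≤ ((Cmd.loop .j (.deg (.var .u)) visitNeighbour).run A s).1.var .count ∧
      ∀ j < s.var .count, ((Cmd.loop .j (.deg (.var .u)) visitNeighbour).run A s).1.arr .queue j =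
        s.arr .queue j := by
  have key := Cmd.run_loop_state (A := A) (x := .j) (e := .deg (.var .u)) (s := s)
    (c := visitNeighbour)
    (I := fun m t => t.var .u = p ∧ SearchInvariant T r i (seen n A p m) t ∧
      s.var .count ≤ t.var .count ∧ ∀ j < s.var .count, t.arr .queue j = s.arr .queue j)
    ⟨hu, by rwa [seen_zero], le_rfl, fun _ _ => rfl⟩ ?_
  · have hd : (Expr.deg (.var .u)).eval A s = (A.adj p).length := by simp [Expr.eval, hu]
    rw [hd, hA.seen_length] at key
    exact key.2
  · rintro m hm t ⟨htu, hinv, hcount, hqueue⟩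
    simp only [Expr.eval, hu] at hm
    obtain ⟨c, hc, hpc, hnot, hseen⟩ := hA.exists_nbr p hm
    have hq : t.arr .queue i = p := (hqueue i hi).trans hp
    simp only [visitNeighbour, Cmd.run_block_cons, Cmd.run_block_nil, Cmd.run_set, Cmd.run_when,
      Cmd.run_store, Expr.eval, State.setVar_var, if_true, if_false, reduceCtorEq, htu, hc, hseen,
      State.setArr_var]
    set t' := (t.setVar .j m).setVar .w c with ht'
    have hinv' : SearchInvariant T r i (seen n A p m) t' :=
      hinv.of_eq (by simp [ht', State.setVar_var]) rfl rfl
    have hcount' : t'.var .count = t.var .count := by simp [ht', State.setVar_var]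
    have hev := hA.eval_internalTest (e := .var .w) (s := t') (v := c) (by simp [Expr.eval, ht'])
    have hcond : (Cond.and (internalTest (.var .w))
        (.not (.eq (.var .w) (.arr .par (.var .u))))).eval A t' = true ↔
        c ∈ childSet T r p ∧ IsInternal T c := by
      rw [Cond.eval_and, hev, Cond.eval_not, Cond.eval_eq, and_comm]
      refine and_congr_left fun _ => ?_
      have := hinv'.par_eq_iff hT (by omega) hq hpc
      have hw : (Expr.var .w).eval A t' = c := by simp [Expr.eval, ht']
      have hpar : (Expr.arr .par (.var .u)).eval A t' = t'.arr .par p := by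
        simp [Expr.eval, ht', State.setVar_var, htu]
      rw [hw, hpar, eq_comm, this, not_not]
    by_cases hcc : c ∈ childSet T r p ∧ IsInternal T c
    · rw [if_pos (hcond.2 hcc)]
      refine ⟨by simp [State.setVar_var, ht', htu], ?_, by simp; omega, ?_⟩
      · have := hinv'.insert_child hT (by omega) hq hcc.1 hcc.2 hnot
        rwa [hcount'] at this
      · intro j hj
        rw [State.setVar_arr, State.setArr_arr, if_neg (by omega), State.setArr_arr,
          if_neg (by simp), ← hqueue j hj]
        rfl
    · rw [if_neg fun h => hcc (hcond.1 h)]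
      exact ⟨by simp [State.setVar_var, ht', htu], hinv'.insert_skip hq hcc, by omega, hqueue⟩

/-- Once `D` is the whole neighbourhood of the vertex at position `i`, that position counts as
finished. If the queue has no position `i`, the iteration is idle; this lets the search run exactly
`n` times. -/
theorem run_visitVertex (hT : T.IsTree) (hA : A.Represents T) {s : State}
    (h : SearchInvariant T r (s.var .i) ∅ s) :
    SearchInvariant T r (s.var .i + 1) ∅ (visitVertex.run A s).1 ∧
      s.var .count ≤ (visitVertex.run A s).1.var .count ∧
      (∀ j < s.var .count, (visitVertex.run A s).1.arr .queue j = s.arr .queue j) ∧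
      (¬ s.var .i < s.var .count → (visitVertex.run A s).1 = s) := by
  rw [visitVertex, Cmd.run_when]
  by_cases hi : s.var .i < s.var .count
  · rw [if_pos ((Cond.eval_lt (.var .i) (.var .count) s).2 hi)]
    obtain ⟨p, -, hp⟩ := h.queue_internal _ hi
    simp only [Cmd.run_block_cons, Cmd.run_block_nil, Cmd.run_set, Expr.eval]
    obtain ⟨h1, h2, h3⟩ := run_visitNeighbours hT hA (s := s.setVar .u (s.arr .queue (s.var .i)))
      (h.of_eq (by simp [State.setVar_var]) rfl rfl) (by simpa [State.setVar_var] using hi) hp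
      (by simpa using hp)
    simp only [State.setVar_var, if_false, reduceCtorEq, State.setVar_arr] at h2 h3
    refine ⟨?_, h2, h3, fun hh => absurd hi hh⟩
    refine ⟨h1.count_pos, h1.queue_zero, h1.par_root, h1.queue_internal, h1.queue_inj, ?_, ?_⟩
    · intro j hj hj0
      obtain ⟨j', hj', q, v, a1, a2, a3, a4, a5⟩ := h1.exists_parent j hj hj0
      exact ⟨j', hj', q, v, a1, a2, a3, a4, by omega⟩
    · intro j hj q d hq hd hdi hor
      refine h1.exists_child j hj q d hq hd hdi ?_
      by_cases hji : j = s.var .i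
      · refine Or.inr ⟨hji, ?_⟩
        rw [hji, h3 _ hi, hp] at hq
        rw [Fin.ext hq]
        exact hd.1
      · have := hor.resolve_right fun h => h.2
        omega
  · rw [if_neg fun hh => hi ((Cond.eval_lt (.var .i) (.var .count) s).1 hh)]
    refine ⟨?_, le_rfl, fun _ _ => rfl, fun _ => rfl⟩
    refine ⟨h.count_pos, h.queue_zero, h.par_root, h.queue_internal, h.queue_inj, ?_, ?_⟩
    · intro j hj hj0
      obtain ⟨j', hj', q, v, a1, a2, a3, a4, a5⟩ := h.exists_parent j hj hj0
      exact ⟨j', hj', q, v, a1, a2, a3, a4, by omega⟩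
    · intro j hj q d hq hd hdi hor
      exact h.exists_child j hj q d hq hd hdi (by omega)

theorem SearchInvariant.sum_cost_le (hA : A.Represents T) (hT : T.IsTree) {i : ℕ}
    {D : Set (Fin n)} {t : State} (h : SearchInvariant T r i D t) (a b : ℕ) :
    ∑ j ∈ Finset.range (t.var .count), (a + b * (A.adj (t.arr .queue j)).length + 1) ≤
      (a + 1 + 2 * b) * n :=
  TreeOneTwo.sum_cost_le hA hT a b (fun j hj => by
    obtain ⟨v, -, hv⟩ := h.queue_internal j hj
    rw [hv]; exact v.2) h.queue_inj

theorem SearchInvariant.count_le (hA : A.Represents T) (hT : T.IsTree) {i : ℕ}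
    {D : Set (Fin n)} {t : State} (h : SearchInvariant T r i D t) : t.var .count ≤ n := by
  simpa using h.sum_cost_le hA hT 0 0

theorem run_search (hT : T.IsTree) (hA : A.Represents T) {s : State}
    (h : SearchInvariant T r 0 ∅ s) :
    SearchInvariant T r n ∅ (search.run A s).1 ∧
      (search.run A s).2 ≤
        2 + (visitVertex.base + 1) * n + (0 + 1 + 2 * visitVertex.slope) * n := by
  have key := Cmd.run_loop_inv (A := A) (x := .i) (e := .size) (s := s) (c := visitVertex)
    -- Only the positions already visited are charged with their degree; idle iterations cost a
    -- constant. Old queue entries are never overwritten, so earlier charges keep their value.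
    (J := fun i t k => SearchInvariant T r i ∅ t ∧ k ≤ 2 + (visitVertex.base + 1) * i +
      visitVertex.slope * ∑ j ∈ Finset.range (min i (t.var .count)),
        (A.adj (t.arr .queue j)).length)
    ⟨h, by simp [Expr.cost]⟩ ?_
  · simp only [Expr.eval, hA.1] at key
    obtain ⟨h1, h2⟩ := key
    refine ⟨h1, h2.trans (Nat.add_le_add_left ?_ _)⟩
    refine le_trans ?_ (h1.sum_cost_le hA hT 0 visitVertex.slope)
    rw [min_eq_right (h1.count_le hA hT), Finset.mul_sum]
    exact Finset.sum_le_sum fun j _ => by omega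
  · rintro i - t k ⟨h1, h2⟩
    have hc : (t.setVar .i i).var .count = t.var .count := by simp [State.setVar_var]
    obtain ⟨h3, h4, h5, h6⟩ := run_visitVertex hT hA (A := A) (s := t.setVar .i i)
      (by rw [State.setVar_var_self]; exact h1.of_eq hc rfl rfl)
    rw [State.setVar_var_self] at h3 h6
    rw [hc] at h4 h5 h6
    refine ⟨h3, ?_⟩
    by_cases hi : i < t.var .count
    · have hcost : (visitVertex.run A (t.setVar .i i)).2 ≤
          visitVertex.base + visitVertex.slope * (A.adj (t.arr .queue i)).length := by
        have := Cmd.cost_when_le (A := A) (b := .lt (.var .i) (.var .count)) (x := .u)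
          (e := .arr .queue (.var .i)) (cs := [.loop .j (.deg (.var .u)) visitNeighbour])
          (by decide) (t.setVar .i i)
        simpa [Expr.eval, visitVertex, Cmd.when, Cmd.block, Cmd.slope] using this
      rw [min_eq_left (by omega), Finset.sum_range_succ, h5 i hi, State.setVar_arr]
      rw [min_eq_left hi.le] at h2
      have hsum : ∑ j ∈ Finset.range i,
          (A.adj ((visitVertex.run A (t.setVar .i i)).1.arr .queue j)).length =
          ∑ j ∈ Finset.range i, (A.adj (t.arr .queue j)).length :=
        Finset.sum_congr rfl fun j hj => by
          rw [h5 j ((Finset.mem_range.1 hj).trans hi), State.setVar_arr]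
      rw [hsum, mul_add, mul_add]
      rw [mul_one]
      omega
    · rw [h6 hi]
      have hcost : (visitVertex.run A (t.setVar .i i)).2 ≤ visitVertex.base := by
        have hf : ¬ (Cond.lt (.var .i) (.var .count)).eval A (t.setVar .i i) = true := by
          rw [Cond.eval_lt]
          simpa [Expr.eval, State.setVar_var] using hi
        simp only [visitVertex, Cmd.when, Cmd.run, if_neg hf, Cmd.base]
        omega
      rw [hc, State.setVar_arr]
      rw [min_eq_right (by omega)] at h2 ⊢
      rw [mul_add, mul_one]
      omega

/-- Induction from the root downwards: the parent is internal, hence queued, at a position below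
`count ≤ n`. All its internal children have then been entered. -/
theorem SearchInvariant.mem_queue (hA : A.Represents T) (hT : T.IsTree) (hr : IsInternal T r)
    {t : State} (h : SearchInvariant T r n ∅ t) {v : Fin n} (hv : IsInternal T v) :
    ∃ j < t.var .count, t.arr .queue j = v := by
  induction hd : T.dist r v using Nat.strong_induction_on generalizing v with
  | _ d ih =>
    by_cases hvr : v = r
    · exact ⟨0, h.count_pos, by rw [h.queue_zero, hvr]⟩
    · obtain ⟨p, hpv, hp⟩ := TreeOneTwo.exists_parent hT hvr
      obtain ⟨j, hj, hjp⟩ := ih _ (hd ▸ dist_lt_of_mem_subtree hT.connected hp hpv.ne)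
        (isInternal_parent hT hr ⟨hpv, hp⟩) rfl
      exact h.exists_child j hj p v hjp ⟨hpv, hp⟩ hv
        (Or.inl (hj.trans_le (h.count_le hA hT)))

/-- Passing from a queued vertex to its parent lowers the position, and repeating this from `u`
leads up to `v`. -/
theorem SearchInvariant.lt_of_mem_subtree {i : ℕ} {D : Set (Fin n)}
    {t : State} (h : SearchInvariant T r i D t) {a b : ℕ} (ha : a < t.var .count)
    (hb : b < t.var .count) {v u : Fin n} (hv : t.arr .queue a = v) (hu : t.arr .queue b = u)
    (hne : v ≠ u) (hvu : u ∈ subtree T r v) : a < b := by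
  induction b using Nat.strong_induction_on generalizing u with
  | _ b ih =>
    by_cases hb0 : b = 0
    · subst hb0
      obtain rfl : u = r := Fin.ext (hu.symm.trans h.queue_zero)
      exact absurd (eq_root_of_root_mem_subtree hvu) hne
    · obtain ⟨b', hb', p, w, hp, hw, hwp, -, -⟩ := h.exists_parent b hb hb0
      obtain rfl : w = u := Fin.ext (hw.symm.trans hu)
      by_cases hvp : v = p
      · rw [h.queue_inj a ha b' (by omega) (hv.trans (hvp ▸ hp.symm))]
        exact hb'
      · exact (ih b' hb' (by omega) hp hvp (mem_subtree_of_parent hvu hne hwp.1)).trans hb'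

theorem run_numberVertices (hT : T.IsTree) (hA : A.Represents T) (hr : IsInternal T r) {s : State}
    (h : SearchInvariant T r n ∅ s) (hroot : s.var .root = r) (hk : s.var .k = s.var .count) :
    IsBottomUpNumbering T r (numberVertices.run A s).1 := by
  obtain ⟨-, hnum⟩ := Cmd.run_loop_state (A := A) (x := .i) (e := .var .count) (s := s)
    (c := .block [.set .k (.pred (.var .k)), .set .u (.arr .queue (.var .i)),
      .store .vert (.var .k) (.var .u), .store .lab (.var .u) (.var .k)])
    (I := fun m t => (t.var .k = s.var .count - m ∧ t.arr .queue = s.arr .queue) ∧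
      -- The queue is numbered backwards, which turns parents before children into descendants
      -- before ancestors.
      ∀ j < m, t.arr .lab (s.arr .queue j) = s.var .count - 1 - j ∧
        t.arr .vert (s.var .count - 1 - j) = s.arr .queue j)
    ⟨⟨by omega, rfl⟩, fun j hj => absurd hj (by omega)⟩ (by
      rintro m hm t ⟨⟨htk, htq⟩, htn⟩
      simp only [Expr.eval] at hm
      simp only [Cmd.run_block_cons, Cmd.run_block_nil, Cmd.run_set, Cmd.run_store, Expr.eval,
        State.setVar_var, if_true, if_false, reduceCtorEq, State.setArr_var, State.setVar_arr, htk,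
        htq]
      refine ⟨⟨by omega, ?_⟩, ?_⟩
      · rw [← htq]
        funext j
        simp [State.setArr_arr]
      · intro j hj
        by_cases hjm : j = m
        · subst hjm
          constructor
          · rw [State.setArr_arr, if_pos ⟨rfl, rfl⟩]
            omega
          · rw [State.setArr_arr, if_neg (by simp), State.setArr_arr, if_pos ⟨rfl, by omega⟩]
        · have hne : s.arr .queue j ≠ s.arr .queue m := fun e =>
            hjm (h.queue_inj j (by omega) m hm e)
          obtain ⟨h1, h2⟩ := htn j (by omega)
          constructor
          · rw [State.setArr_arr, if_neg fun e => hne e.2, State.setArr_arr, if_neg (by simp)]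
            exact h1
          · rw [State.setArr_arr, if_neg (by simp), State.setArr_arr, if_neg (by omega)]
            exact h2)
  simp only [Expr.eval] at hnum
  have hcount : (numberVertices.run A s).1.var .count = s.var .count := Cmd.run_var (by decide) _
  refine ⟨hr, (Cmd.run_var (by decide) _).trans hroot, ?_, ?_, ?_, ?_⟩
  · rw [hcount]
    have himg : s.arr .queue '' Set.Iio (s.var .count) = Fin.val '' {v | IsInternal T v} := by
      ext w
      constructor
      · rintro ⟨j, hj, rfl⟩
        obtain ⟨v, hv, hjv⟩ := h.queue_internal j hj
        exact ⟨v, hv, hjv.symm⟩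
      · rintro ⟨v, hv, rfl⟩
        exact h.mem_queue hA hT hr hv
    have hinj : Set.InjOn (s.arr .queue) (Set.Iio (s.var .count)) :=
      fun j hj j' hj' e => h.queue_inj j hj j' hj' e
    rw [← Set.ncard_image_of_injective _ Fin.val_injective, ← himg, hinj.ncard_image]
    simp
  · intro v hv
    obtain ⟨j, hj, hjv⟩ := h.mem_queue hA hT hr hv
    rw [hcount, ← hjv]
    have := (hnum j hj).1
    rw [numberVertices, this]
    omega
  · intro v hv
    obtain ⟨j, hj, hjv⟩ := h.mem_queue hA hT hr hv
    rw [← hjv]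
    have := hnum j hj
    rw [numberVertices, this.1, this.2]
  · intro u v hu hv hne huv
    obtain ⟨a, ha, hav⟩ := h.mem_queue hA hT hr hv
    obtain ⟨b, hb, hbu⟩ := h.mem_queue hA hT hr hu
    have hab := h.lt_of_mem_subtree ha hb hav hbu hne.symm huv
    rw [← hav, ← hbu, numberVertices, (hnum a ha).1, (hnum b hb).1]
    omega

theorem run_orderFromRoot (hT : T.IsTree) (hA : A.Represents T) (hr : IsInternal T r) {s : State}
    (hroot : s.var .root = r) :
    IsBottomUpNumbering T r ((Cmd.block orderFromRoot).run A s).1 ∧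
      ((Cmd.block orderFromRoot).run A s).2 ≤ 30 + (visitVertex.base + 1) * n +
        (0 + 1 + 2 * visitVertex.slope) * n + n * 20 := by
  set s' := ((s.setArr .queue 0 r).setArr .par r r).setVar .count 1 with hs'
  have hcount : s'.var .count = 1 := by simp [hs']
  have hq0 : s'.arr .queue 0 = r := by simp [hs', State.setArr_arr]
  have hinit : SearchInvariant T r 0 ∅ s' := by
    refine ⟨by omega, hq0, by simp [hs', State.setArr_arr], ?_, ?_, ?_, ?_⟩
    · intro j hj
      obtain rfl : j = 0 := by omega
      exact ⟨r, hr, hq0⟩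
    · intro j hj j' hj' _
      omega
    · intro j hj hj0
      omega
    · intro j hj p c _ _ _ hor
      rcases hor with hor | hor
      · omega
      · exact absurd hor.2 (Set.notMem_empty c)
  obtain ⟨h1, h2⟩ := run_search hT hA hinit
  have hroot' : s'.var .root = r := by simpa [hs', State.setVar_var] using hroot
  set t := (search.run A s').1 with ht
  have hstate : ((Cmd.block orderFromRoot).run A s).1 =
      (numberVertices.run A (t.setVar .k (t.var .count))).1 := by
    simp [orderFromRoot, Cmd.run_block_cons, Cmd.run_block_nil, Cmd.run_set, Cmd.run_store,
      Expr.eval, hroot, ht, hs']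
  have hc : (t.setVar .k (t.var .count)).var .count = t.var .count := by simp [State.setVar_var]
  constructor
  · rw [hstate]
    refine run_numberVertices hT hA hr (h1.of_eq hc rfl rfl) ?_ (by simp [State.setVar_var])
    rw [State.setVar_var, if_neg (by decide), ht, Cmd.run_var (by decide), hroot']
  · have h3 : (numberVertices.run A (t.setVar .k (t.var .count))).2 ≤ 2 + t.var .count * 20 := by
      rw [← hc]
      refine (Cmd.cost_loop_flat (by decide) _).trans ?_
      -- Here `decide` computes the bound for one iteration and checks that it is at most 20.
      refine Nat.add_le_add_left (Nat.mul_le_mul_left _ (by decide)) _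
    have h4 := h1.count_le hA hT
    have hcost : ((Cmd.block orderFromRoot).run A s).2 ≤ 20 + (search.run A s').2 +
        (numberVertices.run A (t.setVar .k (t.var .count))).2 := by
      simp only [orderFromRoot, Cmd.cost_block_cons, Cmd.cost_block_nil, Cmd.run_set,
        Cmd.run_store, Expr.eval, hroot, State.setArr_var]
      rw [← hs', ← ht]
      simp only [Cmd.run, Expr.cost]
      omega
    omega

theorem exists_run_orderPhase : ∃ C : ℕ, ∀ (n : ℕ) (T : SimpleGraph (Fin n)) (_ : T.IsTree)
    (A : Input) (_ : A.Represents T) (s : State), (orderPhase.run A s).2 ≤ C * n ∧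
      (((orderPhase.run A s).1.var .found = 1 ∧
          ∃ r : Fin n, IsBottomUpNumbering T r (orderPhase.run A s).1) ∨
        ((orderPhase.run A s).1.var .found = 0 ∧ ∀ v, ¬ IsInternal T v)) := by
  obtain ⟨a, ha⟩ : ∃ a : ℕ, ∀ (A : Input) s, (findRoot.run A s).2 ≤ 2 + A.n * a :=
    ⟨_, fun A s => Cmd.cost_loop_flat (by decide) s⟩
  refine ⟨a + (visitVertex.base + 1) + (0 + 1 + 2 * visitVertex.slope) + 70,
    fun n T hT A hA s => ?_⟩
  obtain ⟨v₀⟩ := hT.connected.nonempty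
  have hn : 1 ≤ n := Nat.one_le_of_lt v₀.2
  have hroot := run_findRoot hA (A := A) (s := s.setVar .found 0) (by simp)
  have hfind := ha A (s.setVar .found 0)
  rw [hA.1] at hfind
  set t := (findRoot.run A (s.setVar .found 0)).1 with ht
  have hstate : (orderPhase.run A s).1 =
      ((Cmd.when (.eq (.var .found) (.const 1)) orderFromRoot).run A t).1 := rfl
  have hcost : (orderPhase.run A s).2 = 2 + ((findRoot.run A (s.setVar .found 0)).2 +
      (((Cmd.when (.eq (.var .found) (.const 1)) orderFromRoot).run A t).2 + 1 + 1) + 1) + 1 := rfl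
  have hcond := Cond.eval_eq (A := A) (.var .found) (.const 1) t
  simp only [Expr.eval] at hcond
  have hexp : (a + (visitVertex.base + 1) + (0 + 1 + 2 * visitVertex.slope) + 70) * n =
      n * a + (visitVertex.base + 1) * n + (0 + 1 + 2 * visitVertex.slope) * n + 70 * n := by ring
  rw [hstate, hcost, hexp]
  rcases hroot with ⟨hf, r, hr, hrr⟩ | ⟨hf, hnone⟩
  · obtain ⟨h1, h2⟩ := run_orderFromRoot hT hA hr hrr
    rw [Cmd.run_when, if_pos (hcond.2 hf)]
    refine ⟨?_, Or.inl ⟨(Cmd.run_var (by decide) _).trans hf, r, h1⟩⟩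
    simp only [Cmd.when, Cmd.run, if_pos (hcond.2 hf), Cond.cost, Expr.cost]
    omega
  · have hneg : ¬ (Cond.eq (.var .found) (.const 1)).eval A t = true := fun h => by
      have := hcond.1 h
      omega
    rw [Cmd.run_when, if_neg hneg]
    refine ⟨?_, Or.inr ⟨hf, hnone⟩⟩
    simp only [Cmd.when, Cmd.run, if_neg hneg, Cond.cost, Expr.cost]
    omega

end OrderPhase
end TreeOneTwo

/-! ### Assembling the two phases -/

theorem mainTheorem4 :
    ∃ C : ℕ, ∀ (n : ℕ) (T : SimpleGraph (Fin n)) (_ : T.IsTree)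
      (A : TreeOneTwo.Input) (_ : A.Represents T),
      -- the whole algorithm, from any initial memory
      (∀ s : TreeOneTwo.State,
        TreeOneTwo.AnswerCorrect T (TreeOneTwo.treeAlgorithm.run A s).1 ∧
        (TreeOneTwo.treeAlgorithm.run A s).2 ≤ C * n) ∧
      -- the first phase makes an admissible choice in linear time
      (∀ s : TreeOneTwo.State, 3 ≤ n →
        (∃ r : Fin n, TreeOneTwo.IsBottomUpNumbering T r (TreeOneTwo.orderPhase.run A s).1) ∧
        (TreeOneTwo.orderPhase.run A s).2 ≤ C * n) ∧
      -- the second phase, for every admissible choice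
      (∀ (r : Fin n) (s : TreeOneTwo.State), TreeOneTwo.IsBottomUpNumbering T r s →
        TreeOneTwo.AnswerCorrect T (TreeOneTwo.labelPhase.run A s).1 ∧
        (TreeOneTwo.labelPhase.run A s).2 ≤ C * n ∧
        ∀ v : Fin n, TreeOneTwo.IsInternal T v →
          (∀ u : Fin n, TreeOneTwo.IsInternal T u → s.arr .lab u < s.arr .lab v →
            (TreeOneTwo.possibleLabels T r u).Nonempty) →
          TreeOneTwo.labelList (TreeOneTwo.labelPhase.run A s).1 v =
            TreeOneTwo.possibleLabels T r v) := by
  obtain ⟨C₁, h₁⟩ := TreeOneTwo.exists_run_orderPhase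
  obtain ⟨C₂, h₂⟩ := TreeOneTwo.exists_cost_labelPhase_le
  -- The 20 absorbs the fixed number of steps outside the two phases; a tree is nonempty, so these
  -- are at most `20 * n`.
  refine ⟨C₁ + C₂ + 20, fun n T hT A hA => ?_⟩
  obtain ⟨v₀⟩ := hT.connected.nonempty
  have hn : 1 ≤ n := Nat.one_le_of_lt v₀.2
  have hexp : (C₁ + C₂ + 20) * n = C₁ * n + C₂ * n + 20 * n := by ring
  rw [hexp]
  refine ⟨fun s => ?_, fun s h3 => ?_, fun r s h => ?_⟩
  · obtain ⟨hcost, hcase⟩ := h₁ n T hT A hA s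
    set t := (TreeOneTwo.orderPhase.run A s).1 with ht
    let b : TreeOneTwo.Cond := .eq (.var .found) (.const 1)
    let c : TreeOneTwo.Cmd := .ite b TreeOneTwo.labelPhase (.set .answer (.const 1))
    have hrun : (TreeOneTwo.treeAlgorithm.run A s).1 = (c.run A t).1 := rfl
    have hrun' : (TreeOneTwo.treeAlgorithm.run A s).2 =
        (TreeOneTwo.orderPhase.run A s).2 + ((c.run A t).2 + 1 + 1) + 1 := rfl
    have hb : b.eval A t = true ↔ t.var .found = 1 := TreeOneTwo.Cond.eval_eq _ _ _
    rw [hrun, hrun']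
    rcases hcase with ⟨hf, r, hr⟩ | ⟨hf, hnone⟩
    · have hc := h₂ n T hT A hA r t hr
      simp only [c, TreeOneTwo.Cmd.run, if_pos (hb.2 hf)]
      refine ⟨(TreeOneTwo.run_labelPhase hT hA hr).1, ?_⟩
      simp only [b, TreeOneTwo.Cond.cost, TreeOneTwo.Expr.cost]
      omega
    · have hneg : ¬ b.eval A t = true := fun h => by
        have := hb.1 h
        omega
      simp only [c, TreeOneTwo.Cmd.run, if_neg hneg]
      refine ⟨Or.inl ⟨by simp [TreeOneTwo.Expr.eval],
        TreeOneTwo.exists_isIndepOneTwoSet_of_no_internal hT hnone⟩, ?_⟩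
      simp only [b, TreeOneTwo.Cond.cost, TreeOneTwo.Expr.cost]
      omega
  · obtain ⟨hcost, hcase⟩ := h₁ n T hT A hA s
    refine ⟨?_, by omega⟩
    rcases hcase with ⟨-, hr⟩ | ⟨-, hnone⟩
    · exact hr
    · obtain ⟨v, hv⟩ := TreeOneTwo.exists_isInternal hT (by simpa using h3)
      exact absurd hv (hnone v)
  · obtain ⟨ha, hl⟩ := TreeOneTwo.run_labelPhase hT hA h
    have hc := h₂ n T hT A hA r s h
    exact ⟨ha, by omega, hl⟩
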